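/- All sheaves are sheaves of abelian groups. For a topological space $X$ and a sheaf $\mathscr F$ on $X$ let $0\to\mathscr F\to\mathscr A^0(\mathscr F)\to\mathscr A^1(\mathscr F)\to\cdots$ be the canonical (flabby) resolution: $\mathscr A^0(\mathscr F)$ is the sheaf of discontinuous sections $U\mapsto\prod_{x\in U}\mathscr F_x$, $\mathscr B^0(\mathscr F)=\mathscr F$, $\mathscr B^{p+1}(\mathscr F)=\mathscr A^0(\mathscr B^p(\mathscr F))/\mathscr B^p(\mathscr F)$ and $\mathscr A^p(\mathscr F)=\mathscr A^0(\mathscr B^p(\mathscr F))$. Cohomology is $H^p(X,\mathscr F)=H^p(\Gamma(X,\mathscr A^\bullet(\mathscr F)))$, and for a continuous map $f:M\to N$ and a sheaf $\mathscr S$ on $M$ the higher direct images are $R^qf_*\mathscr S=\mathcal H^q(f_*\mathscr A^\bullet(\mathscr S))$. The Leray spectral sequence of $(\mathscr S,f)$, with $E_2^{p,q}=H^p(N,R^qf_*\mathscr S)$, is the spectral sequence of the total complex of the double complex $A^{p,q}=\Gamma(N,\mathscr A^p(f_*\mathscr A^q(\mathscr S)))$, with total differential $(-1)^{p+q}\partial+\bar\partial$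 ($\partial$ in the direction of $p$, $\bar\partial$ in the direction of $q$), filtered by $F^iA^n=\bigoplus_{p+q=n,\,p\ge i}A^{p,q}$. Theorem. Let $f:M\to N$ be a continuous map of topological spaces, $\mathscr S$ a sheaf of abelian groups on $M$, $N'\subset N$ an open subset, $M'=f^{-1}(N')$, $f'=f|_{M'}:M'\to N'$ and $\mathscr S'=\mathscr S|_{M'}$. Then for every $i\ge0$ restriction of sections induces an isomorphism $(R^if_*\mathscr S)|_{N'}\simeq R^if'_*\mathscr S'$, natural in $\mathscr S$, and for all $p\ge 0$ and $q\ge 1$ the diagram $$\begin{array}{ccc} H^p(N,R^qf_*\mathscr S)&\xrightarrow{\;d_2\;}&H^{p+2}(N,R^{q-1}f_*\mathscr S)\\ \downarrow&&\downarrow\\ H^p(N',R^qf'_*\mathscr S')&\xrightarrow{\;d_2'\;}&H^{p+2}(N',R^{q-1}f'_*\mathscr S') \end{array}$$ commutes, where $d_2$ and $d_2'$ are the differentials on the second terms of the Leray spectral sequences of $(\mathscr S,f)$ and $(\mathscr S',f')$, and the vertical maps are the restriction $H^\bullet(N,R^if_*\mathscr S)\to H^\bullet(N',(R^if_*\mathscr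 S)|_{N'})$ from $N$ to $N'$ followed by the map induced by the isomorphism $(R^if_*\mathscr S)|_{N'}\simeq R^if'_*\mathscr S'$. -/

import Mathlib

open CategoryTheory Limits TopologicalSpace Opposite

universe u

namespace Leray

/-- The category of sheaves of abelian groups on a topological space. -/
abbrev AbSheaf (X : TopCat.{u}) := TopCat.Sheaf AddCommGrpCat.{u} X

noncomputable section Godement

variable {X Y : TopCat.{u}}

lemma AbSheaf.hom_ext {F G : AbSheaf X} {φ ψ : F ⟶ G}
    (h : ∀ (U : (Opens X)ᵒᵖ) (s : F.presheaf.obj U), φ.hom.app U s = ψ.hom.app U s) : φ = ψ := by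
  apply Sheaf.hom_ext
  ext U s
  exact h U s

/-- The presheaf `U ↦ ∏_{x ∈ U} F_x` of discontinuous sections of `F`. -/
def discPresheaf (F : AbSheaf X) : TopCat.Presheaf AddCommGrpCat.{u} X where
  obj U := AddCommGrpCat.of (∀ x : U.unop, F.presheaf.stalk (x : X))
  map i := AddCommGrpCat.ofHom
    { toFun := fun s x => s ⟨x.1, i.unop.le x.2⟩
      map_zero' := rfl
      map_add' := fun _ _ => rfl }

lemma discPresheaf_isSheaf (F : AbSheaf X) : (discPresheaf F).IsSheaf :=
  (TopCat.Presheaf.isSheaf_iff_isSheaf_comp (forget AddCommGrpCat.{u}) _).2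
    (TopCat.Presheaf.toTypes_isSheaf X fun x => F.presheaf.stalk x)

/-- The sheaf `𝒜⁰(F)` of discontinuous sections of `F`. -/
def discObj (F : AbSheaf X) : AbSheaf X := ⟨discPresheaf F, discPresheaf_isSheaf F⟩

/-- The homomorphism of stalks induced by a morphism of sheaves. -/
def stalkMap (x : X) {F G : AbSheaf X} (φ : F ⟶ G) : F.presheaf.stalk x →+ G.presheaf.stalk x :=
  ((TopCat.Presheaf.stalkFunctor _ x).map φ.hom).hom

lemma stalkMap_germ (x : X) {F G : AbSheaf X} (φ : F ⟶ G) (U : Opens X) (hx : x ∈ U)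
    (s : F.presheaf.obj (op U)) :
    stalkMap x φ (F.presheaf.germ U x hx s) = G.presheaf.germ U x hx (φ.hom.app (op U) s) :=
  TopCat.Presheaf.stalkFunctor_map_germ_apply U x hx φ.hom s

lemma stalkMap_id (x : X) (F : AbSheaf X) : stalkMap x (𝟙 F) = AddMonoidHom.id _ :=
  congrArg AddCommGrpCat.Hom.hom ((TopCat.Presheaf.stalkFunctor AddCommGrpCat x).map_id F.presheaf)

lemma stalkMap_comp (x : X) {F G H : AbSheaf X} (φ : F ⟶ G) (ψ : G ⟶ H) :
    stalkMap x (φ ≫ ψ) = (stalkMap x ψ).comp (stalkMap x φ) :=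
  congrArg AddCommGrpCat.Hom.hom
    ((TopCat.Presheaf.stalkFunctor AddCommGrpCat x).map_comp φ.hom ψ.hom)

lemma stalkMap_add (x : X) {F G : AbSheaf X} (φ ψ : F ⟶ G) :
    stalkMap x (φ + ψ) = stalkMap x φ + stalkMap x ψ :=
  congrArg AddCommGrpCat.Hom.hom
    ((TopCat.Presheaf.stalkFunctor AddCommGrpCat.{u} x).map_add (X := F.presheaf)
      (Y := G.presheaf) (f := φ.hom) (g := ψ.hom))

/-- `𝒜⁰` as an endofunctor of the category of abelian sheaves. -/
def disc (X : TopCat.{u}) : AbSheaf X ⥤ AbSheaf X where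
  obj := discObj
  map {F G} φ := ⟨{
    app := fun U => AddCommGrpCat.ofHom
      { toFun := fun s x => stalkMap (x : X) φ (s x)
        map_zero' := by ext x; exact map_zero _
        map_add' := fun s t => by ext x; exact map_add _ _ _ }
    naturality := fun _ _ _ => rfl }⟩
  map_id F := AbSheaf.hom_ext fun _ s => funext fun x =>
    DFunLike.congr_fun (stalkMap_id (x : X) F) (s x)
  map_comp φ ψ := AbSheaf.hom_ext fun _ s => funext fun x =>
    DFunLike.congr_fun (stalkMap_comp (x : X) φ ψ) (s x)

instance : (disc X).Additive where
  map_add {_ _ φ ψ} := AbSheaf.hom_ext fun _ s => funext fun x =>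
    DFunLike.congr_fun (stalkMap_add (x : X) φ ψ) (s x)

/-- The inclusion `F ⟶ 𝒜⁰(F)` sending a section to the family of its germs. -/
def toDisc (X : TopCat.{u}) : 𝟭 (AbSheaf X) ⟶ disc X where
  app F := ⟨{
    app := fun U => AddCommGrpCat.ofHom
      { toFun := fun s x => F.presheaf.germ U.unop x x.2 s
        map_zero' := by ext x; exact map_zero _
        map_add' := fun s t => by ext x; exact map_add _ _ _ }
    naturality := fun U V i => by
      ext s
      funext x
      exact TopCat.Presheaf.germ_res_apply' F.presheaf i x.1 x.2 s }⟩
  naturality _ _ φ := AbSheaf.hom_ext fun U s => funext fun x =>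
    (stalkMap_germ x.1 φ U.unop x.2 s).symm

/-- `ℬ¹(F) = 𝒜⁰(F) / F`. -/
def discQuot (X : TopCat.{u}) : AbSheaf X ⥤ AbSheaf X where
  obj F := cokernel ((toDisc X).app F)
  map φ := cokernel.map _ _ φ ((disc X).map φ) ((toDisc X).naturality φ).symm

instance : (discQuot X).Additive where
  map_add {F G φ ψ} := by
    apply coequalizer.hom_ext
    refine Eq.trans ?_ (Preadditive.comp_add ..).symm
    simp [discQuot, Functor.map_add, Preadditive.add_comp]
    rfl

/-- The projection `𝒜⁰(F) ⟶ ℬ¹(F)`. -/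
def discProj (X : TopCat.{u}) : disc X ⟶ discQuot X where
  app F := cokernel.π _
  naturality F G φ := by simp [discQuot]

/-- `ℬᵖ(F)`: `ℬ⁰(F) = F` and `ℬᵖ⁺¹(F) = 𝒜⁰(ℬᵖ(F)) / ℬᵖ(F)`. -/
def canB (X : TopCat.{u}) : ℕ → (AbSheaf X ⥤ AbSheaf X)
  | 0 => 𝟭 _
  | p + 1 => canB X p ⋙ discQuot X

instance canB_additive (p : ℕ) : (canB X p).Additive := by
  induction p with
  | zero => exact inferInstanceAs (𝟭 _ : AbSheaf X ⥤ AbSheaf X).Additive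
  | succ p ih => exact inferInstanceAs (canB X p ⋙ discQuot X).Additive

/-- `𝒜ᵖ(F) = 𝒜⁰(ℬᵖ(F))`. -/
def canA (X : TopCat.{u}) (p : ℕ) : AbSheaf X ⥤ AbSheaf X := canB X p ⋙ disc X

instance (p : ℕ) : (canA X p).Additive := inferInstanceAs (canB X p ⋙ disc X).Additive

/-- The differential `𝒜ᵖ(F) ⟶ ℬᵖ⁺¹(F) ⟶ 𝒜ᵖ⁺¹(F)`. -/
def canD (X : TopCat.{u}) (p : ℕ) : canA X p ⟶ canA X (p + 1) :=
  Functor.whiskerLeft (canB X p) (discProj X) ≫ Functor.whiskerLeft (canB X (p + 1)) (toDisc X)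

lemma discProj_toDisc_comp (F : AbSheaf X) :
    ((discProj X).app F ≫ (toDisc X).app ((discQuot X).obj F)) ≫
      (discProj X).app ((discQuot X).obj F) ≫
        (toDisc X).app ((discQuot X).obj ((discQuot X).obj F)) = 0 := by
  have h : (toDisc X).app ((discQuot X).obj F) ≫ (discProj X).app ((discQuot X).obj F) = 0 :=
    cokernel.condition _
  rw [Category.assoc, reassoc_of% h, zero_comp, comp_zero]

lemma canD_comp (p : ℕ) (F : AbSheaf X) : (canD X p).app F ≫ (canD X (p + 1)).app F = 0 :=
  discProj_toDisc_comp ((canB X p).obj F)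

/-- The canonical resolution `𝒜⁰(F) ⟶ 𝒜¹(F) ⟶ ⋯` of `F`. -/
def canResObj (F : AbSheaf X) : CochainComplex (AbSheaf X) ℕ :=
  CochainComplex.of (fun p => (canA X p).obj F) (fun p => (canD X p).app F)
    fun p => canD_comp p F

lemma canResObj_d (F : AbSheaf X) (p : ℕ) :
    (canResObj F).d p (p + 1) = (canD X p).app F :=
  CochainComplex.of_d (fun p => (canA X p).obj F) (fun p => (canD X p).app F) p

/-- The canonical resolution as a functor. -/
def canRes (X : TopCat.{u}) : AbSheaf X ⥤ CochainComplex (AbSheaf X) ℕ where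
  obj F := canResObj F
  map {F G} φ := CochainComplex.ofHom (fun p => (canA X p).map φ) fun p => by
    rw [canResObj_d, canResObj_d]
    exact (canD X p).naturality φ
  map_id F := by ext p : 1; exact (canA X p).map_id F
  map_comp φ ψ := by ext p : 1; exact (canA X p).map_comp φ ψ

/-- Global sections. -/
def sections (X : TopCat.{u}) : AbSheaf X ⥤ AddCommGrpCat.{u} :=
  TopCat.Sheaf.forget _ X ⋙ (evaluation _ _).obj (op ⊤)

instance : (sections X).Additive where
  map_add := rfl

instance (g : X ⟶ Y) : (TopCat.Sheaf.pushforward AddCommGrpCat.{u} g).Additive where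
  map_add := rfl

/-- Sheaf cohomology `Hᵖ(X, F)`: the cohomology of the global sections of the canonical
resolution. -/
def cohomology (X : TopCat.{u}) (p : ℕ) : AbSheaf X ⥤ AddCommGrpCat.{u} :=
  canRes X ⋙ (sections X).mapHomologicalComplex _ ⋙ HomologicalComplex.homologyFunctor _ _ p

/-- The complex `f_* 𝒜^*(S)`. -/
def directImageComplex (f : X ⟶ Y) : AbSheaf X ⥤ CochainComplex (AbSheaf Y) ℕ :=
  canRes X ⋙ (TopCat.Sheaf.pushforward _ f).mapHomologicalComplex _

/-- The higher direct image `R^q f_* S`: the cohomology sheaf in degree `q` of `f_* 𝒜^*(S)`. -/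
def higherDirectImage (f : X ⟶ Y) (q : ℕ) : AbSheaf X ⥤ AbSheaf Y :=
  directImageComplex f ⋙ HomologicalComplex.homologyFunctor _ _ q

end Godement

section Exactness
variable {X : TopCat.{u}}

lemma stalkMap_exact {F G H : AbSheaf X} {φ : F ⟶ G} {ψ : G ⟶ H} {w : φ ≫ ψ = 0}
    (h : (ShortComplex.mk φ ψ w).Exact) (x : X) (t : G.presheaf.stalk x)
    (ht : stalkMap x ψ t = 0) : ∃ u, stalkMap x φ u = t :=
  (ShortComplex.ab_exact_iff _).1 ((TopCat.Sheaf.exact_iff_stalkFunctor_map_exact _).1 h x) t ht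

lemma exact_of_stalkMap {F G H : AbSheaf X} {φ : F ⟶ G} {ψ : G ⟶ H} (w : φ ≫ ψ = 0)
    (h : ∀ (x : X) (t : G.presheaf.stalk x), stalkMap x ψ t = 0 → ∃ u, stalkMap x φ u = t) :
    (ShortComplex.mk φ ψ w).Exact :=
  (TopCat.Sheaf.exact_iff_stalkFunctor_map_exact _).2 fun x =>
    (ShortComplex.ab_exact_iff _).2 (h x)

lemma stalkMap_zero (x : X) (F G : AbSheaf X) : stalkMap x (0 : F ⟶ G) = 0 :=
  congrArg AddCommGrpCat.Hom.hom
    (Functor.map_zero (TopCat.Presheaf.stalkFunctor AddCommGrpCat.{u} x) F.presheaf G.presheaf)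

/-- `F ↦ 𝒜⁰(F)(U)` is exact. -/
lemma disc_sections_exact {S : ShortComplex (AbSheaf X)} (hS : S.Exact) (U : (Opens X)ᵒᵖ)
    (s : ((disc X).obj S.X₂).presheaf.obj U) (hs : ((disc X).map S.g).hom.app U s = 0) :
    ∃ t : ((disc X).obj S.X₁).presheaf.obj U, ((disc X).map S.f).hom.app U t = s := by
  have key : ∀ x : U.unop, ∃ t, stalkMap (x : X) S.f t = s x := fun x =>
    stalkMap_exact hS (x : X) (s x) (congrFun hs x)
  choose t ht using key
  exact ⟨t, funext ht⟩

lemma disc_exact {S : ShortComplex (AbSheaf X)} (hS : S.Exact) : (S.map (disc X)).Exact := by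
  refine exact_of_stalkMap _ fun x s hs => ?_
  obtain ⟨U, hxU, s, rfl⟩ := TopCat.Presheaf.exists_germ_eq _ s
  have hs' := (stalkMap_germ x _ U hxU s).symm.trans (hs.trans (map_zero
    (((disc X).obj S.X₃).presheaf.germ U x hxU).hom).symm)
  obtain ⟨W, hxW, i₁, i₂, h⟩ := TopCat.Presheaf.germ_eq _ x hxU hxU _ _ hs'
  obtain ⟨t, ht⟩ := disc_sections_exact hS (op W) (((disc X).obj S.X₂).presheaf.map i₁.op s) (by
    refine Eq.trans ?_ (h.trans (map_zero _))
    exact ConcreteCategory.congr_hom (((disc X).map S.g).hom.naturality i₁.op) s)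
  refine ⟨((disc X).obj S.X₁).presheaf.germ W x hxW t, ?_⟩
  refine (stalkMap_germ x ((disc X).map S.f) W hxW t).trans ?_
  refine (congrArg _ ht).trans ?_
  exact TopCat.Presheaf.germ_res_apply _ _ _ _ _

/-- The evaluation `(𝒜⁰ F)_x → F_x`, a retraction of the inclusion of stalks `F_x → (𝒜⁰ F)_x`. -/
noncomputable def discStalk (x : X) (F : AbSheaf X) :
    ((disc X).obj F).presheaf.stalk x →+ F.presheaf.stalk x :=
  AddCommGrpCat.Hom.hom <|
  colimit.desc ((OpenNhds.inclusion x).op ⋙ ((disc X).obj F).presheaf)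
    { pt := F.presheaf.stalk x
      ι :=
        { app := fun U => AddCommGrpCat.ofHom (X := ∀ y : U.unop.1, F.presheaf.stalk (y : X))
            { toFun := fun s => s ⟨x, U.unop.2⟩
              map_zero' := rfl
              map_add' := fun _ _ => rfl }
          naturality := fun _ _ _ => rfl } }

lemma discStalk_germ (x : X) (F : AbSheaf X) (U : Opens X) (hx : x ∈ U)
    (s : ∀ y : U, F.presheaf.stalk (y : X)) :
    discStalk x F (((disc X).obj F).presheaf.germ U x hx s) = s ⟨x, hx⟩ :=
  ConcreteCategory.congr_hom
    (colimit.ι_desc (F := (OpenNhds.inclusion x).op ⋙ ((disc X).obj F).presheaf) _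
      (op (⟨U, hx⟩ : OpenNhds x))) s

lemma discStalk_toDisc (x : X) (F : AbSheaf X) (t : F.presheaf.stalk x) :
    discStalk x F (stalkMap x ((toDisc X).app F) t) = t := by
  obtain ⟨U, hxU, s, rfl⟩ := TopCat.Presheaf.exists_germ_eq _ t
  exact (congrArg _ (stalkMap_germ x ((toDisc X).app F) U hxU s)).trans (discStalk_germ _ _ _ _ _)

lemma discStalk_map (x : X) {F G : AbSheaf X} (φ : F ⟶ G)
    (t : ((disc X).obj F).presheaf.stalk x) :
    discStalk x G (stalkMap x ((disc X).map φ) t) = stalkMap x φ (discStalk x F t) := by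
  obtain ⟨U, hxU, s, rfl⟩ := TopCat.Presheaf.exists_germ_eq _ t
  refine (congrArg _ (stalkMap_germ x ((disc X).map φ) U hxU s)).trans ?_
  refine (discStalk_germ _ _ _ _ _).trans ?_
  exact (congrArg _ (discStalk_germ x F U hxU s)).symm

lemma stalkMap_comm (x : X) {F G H K : AbSheaf X} {a : F ⟶ G} {b : G ⟶ K} {c : F ⟶ H} {d : H ⟶ K}
    (h : a ≫ b = c ≫ d) (t : F.presheaf.stalk x) :
    stalkMap x b (stalkMap x a t) = stalkMap x d (stalkMap x c t) := by
  have := DFunLike.congr_fun (congrArg (stalkMap x) h) t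
  rwa [stalkMap_comp, stalkMap_comp] at this

lemma discQuot_exact {S : ShortComplex (AbSheaf X)} (hS : S.Exact) :
    (S.map (discQuot X)).Exact := by
  refine exact_of_stalkMap _ fun x b hb => ?_
  have hw (F : AbSheaf X) : (toDisc X).app F ≫ (discProj X).app F = 0 := cokernel.condition _
  have hex (F : AbSheaf X) : (ShortComplex.mk _ _ (hw F)).Exact :=
    ShortComplex.exact_cokernel ((toDisc X).app F)
  have : Epi ((discProj X).app S.X₂) := inferInstanceAs (Epi (cokernel.π _))
  obtain ⟨t, rfl⟩ := stalkMap_exact ((ShortComplex.exact_iff_epi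
    (ShortComplex.mk ((discProj X).app S.X₂)
    (0 : (discQuot X).obj S.X₂ ⟶ (discQuot X).obj S.X₂) comp_zero) rfl).2 this) x b
    (by rw [stalkMap_zero]; rfl)
  obtain ⟨u, hu⟩ := stalkMap_exact (hex S.X₃) x _
    ((stalkMap_comm x ((discProj X).naturality S.g) t).trans hb)
  have hu' : u = stalkMap x S.g (discStalk x S.X₂ t) := by
    rw [← discStalk_map, ← hu]; exact (discStalk_toDisc x S.X₃ u).symm
  obtain ⟨v, hv⟩ := stalkMap_exact (disc_exact hS) x
    (t - stalkMap x ((toDisc X).app S.X₂) (discStalk x S.X₂ t)) (by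
      refine (map_sub (stalkMap x ((disc X).map S.g)) _ _).trans (sub_eq_zero.2 ?_)
      refine hu.symm.trans ?_
      rw [hu']
      exact stalkMap_comm x ((toDisc X).naturality S.g) _)
  refine ⟨stalkMap x ((discProj X).app S.X₁) v, ?_⟩
  refine (stalkMap_comm x ((discProj X).naturality S.f) v).symm.trans ?_
  refine (congrArg (stalkMap x ((discProj X).app S.X₂)) hv).trans ?_
  refine (map_sub (stalkMap x ((discProj X).app S.X₂)) _ _).trans (sub_eq_self.2 ?_)
  have := DFunLike.congr_fun (congrArg (stalkMap x) (hw S.X₂)) (discStalk x S.X₂ t)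
  rwa [stalkMap_comp, stalkMap_zero] at this

lemma canB_exact (p : ℕ) {S : ShortComplex (AbSheaf X)} (hS : S.Exact) :
    (S.map (canB X p)).Exact := by
  induction p with
  | zero => exact hS
  | succ p ih => exact discQuot_exact (S := S.map (canB X p)) ih

/-- The functor `F ↦ Γ(X, 𝒜ᵖ(F))`. -/
noncomputable abbrev canΓ (X : TopCat.{u}) (p : ℕ) : AbSheaf X ⥤ AddCommGrpCat.{u} := canA X p ⋙ sections X

lemma canΓ_exact (p : ℕ) {S : ShortComplex (AbSheaf X)} (hS : S.Exact) :
    (S.map (canΓ X p)).Exact := by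
  rw [ShortComplex.ab_exact_iff]
  exact disc_sections_exact (canB_exact p hS) (op ⊤)

lemma canΓ_preserves (p : ℕ) :
    PreservesFiniteLimits (canΓ X p) ∧ PreservesFiniteColimits (canΓ X p) :=
  ((canΓ X p).exact_tfae.out 1 3).1 fun _ => canΓ_exact p

lemma canΓ_injective (p : ℕ) {F G : AbSheaf X} (φ : F ⟶ G) [Mono φ] :
    Function.Injective ((canΓ X p).map φ) := by
  have := (canΓ_preserves (X := X) p).1
  exact (AddCommGrpCat.mono_iff_injective _).1 inferInstance

lemma canΓ_surjective (p : ℕ) {F G : AbSheaf X} (φ : F ⟶ G) [Epi φ] :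
    Function.Surjective ((canΓ X p).map φ) := by
  have := (canΓ_preserves (X := X) p).2
  exact (AddCommGrpCat.epi_iff_surjective _).1 inferInstance

end Exactness

noncomputable section SpectralSequences

/-- A cochain complex of abelian groups with a decreasing filtration by subcomplexes
`C = F⁰ ⊇ F¹ ⊇ ⋯`. -/
structure FilteredComplex where
  /-- the complex -/
  C : CochainComplex AddCommGrpCat.{u} ℕ
  /-- the `i`-th step of the filtration in degree `n` -/
  F : ℕ → ∀ n : ℕ, AddSubgroup (C.X n)
  F_zero : ∀ n : ℕ, F 0 n = ⊤
  anti : ∀ {i j : ℕ} (n : ℕ), i ≤ j → F j n ≤ F i n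
  d_mem : ∀ {i n : ℕ} {x : C.X n}, x ∈ F i n → C.d n (n + 1) x ∈ F i (n + 1)

namespace FilteredComplex

variable (T : FilteredComplex.{u})

/-- `Z_r^{i,n-i} = {x ∈ Fⁱ Cⁿ : dx ∈ F^{i+r} Cⁿ⁺¹}`. -/
def Z (r i n : ℕ) : AddSubgroup (T.C.X n) :=
  T.F i n ⊓ (T.F (i + r) (n + 1)).comap (T.C.d n (n + 1)).hom

/-- `B_r^{i,n-i} = (d(F^{i-r+1} Cⁿ⁻¹) ∩ Fⁱ Cⁿ) + Z_{r-1}^{i+1,n-i-1}`. The truncated subtraction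
`i + 1 - r` is harmless because the filtration starts at `F⁰ = C`; the differential
`d (n - 1) n` is zero for `n = 0`. -/
def B (r i n : ℕ) : AddSubgroup (T.C.X n) :=
  ((T.F (i + 1 - r) (n - 1)).map (T.C.d (n - 1) n).hom ⊓ T.F i n) ⊔
    (T.F (i + 1) n ⊓ (T.F (i + r) (n + 1)).comap (T.C.d n (n + 1)).hom)

/-- The term `E_r^{i,n-i} = Z_r^{i,n-i} / B_r^{i,n-i}` of the spectral sequence. -/
abbrev E (r i n : ℕ) : Type u := T.Z r i n ⧸ (T.B r i n).addSubgroupOf (T.Z r i n)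

lemma d_d {n m k : ℕ} (x : T.C.X n) : T.C.d m k (T.C.d n m x) = 0 :=
  ConcreteCategory.congr_hom (T.C.d_comp_d n m k) x

/-- The differential restricted to `Z_r`. -/
def dZ (r i n : ℕ) : T.Z r i n →+ T.Z r (i + r) (n + 1) where
  toFun x := ⟨T.C.d n (n + 1) x.1, x.2.2, by
    have h : T.C.d (n + 1) (n + 1 + 1) (T.C.d n (n + 1) x.1) = 0 := T.d_d x.1
    exact AddSubgroup.mem_comap.2 (h ▸ zero_mem _)⟩
  map_zero' := Subtype.ext (map_zero (T.C.d n (n + 1)).hom)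
  map_add' x y := Subtype.ext (map_add (T.C.d n (n + 1)).hom x.1 y.1)

lemma dZ_mem (r i n : ℕ) : (T.B r i n).addSubgroupOf (T.Z r i n) ≤
    ((T.B r (i + r) (n + 1)).addSubgroupOf (T.Z r (i + r) (n + 1))).comap (T.dZ r i n) := by
  rintro ⟨x, hx⟩ h
  obtain ⟨b, ⟨⟨y, hy, rfl⟩, hb⟩, z, hz, e⟩ := AddSubgroup.mem_sup.1 (show x ∈ T.B r i n from h)
  change T.C.d n (n + 1) x ∈ T.B r (i + r) (n + 1)
  refine AddSubgroup.mem_sup_left ⟨⟨z, ?_, ?_⟩, hx.2⟩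
  · have e : i + r + 1 - r = i + 1 := by omega
    rw [e]; exact hz.1
  · rw [← e]
    refine Eq.symm ((map_add (T.C.d n (n + 1)).hom _ _).trans ?_)
    exact add_eq_right.2 (T.d_d y)

/-- The differential `d_r : E_r^{i,n-i} → E_r^{i+r,n+1-(i+r)}` of the spectral sequence. -/
def d (r i n : ℕ) : T.E r i n →+ T.E r (i + r) (n + 1) :=
  QuotientAddGroup.map _ _ (T.dZ r i n) (T.dZ_mem r i n)

end FilteredComplex

/-- A first quadrant double cochain complex of abelian groups, with commuting differentials
`∂ : A^{p,q} → A^{p+1,q}` and `∂̄ : A^{p,q} → A^{p,q+1}`. -/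
structure DoubleComplex where
  /-- the groups `A^{p,q}` -/
  A : ℕ → ℕ → AddCommGrpCat.{u}
  /-- the differential `∂` -/
  dh : ∀ p q, A p q →+ A (p + 1) q
  /-- the differential `∂̄` -/
  dv : ∀ p q, A p q →+ A p (q + 1)
  dh_dh : ∀ p q x, dh (p + 1) q (dh p q x) = 0
  dv_dv : ∀ p q x, dv p (q + 1) (dv p q x) = 0
  comm : ∀ p q x, dh p (q + 1) (dv p q x) = dv (p + 1) q (dh p q x)

namespace DoubleComplex

variable (A : DoubleComplex.{u})

/-- `Aⁿ = ⨁_{p+q=n} A^{p,q}`. -/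
abbrev TotX (n : ℕ) : Type u := ∀ i : {i : ℕ × ℕ // i.1 + i.2 = n}, A.A i.1.1 i.1.2

/-- The part `(-1)^{p+q} ∂` of the total differential. -/
def totH {n : ℕ} (x : A.TotX n) : ∀ a b : ℕ, a + b = n + 1 → A.A a b
  | 0, _, _ => 0
  | a + 1, b, h => (-1 : ℤ) ^ n • A.dh a b (x ⟨(a, b), by lia⟩)

/-- The part `∂̄` of the total differential. -/
def totV {n : ℕ} (x : A.TotX n) : ∀ a b : ℕ, a + b = n + 1 → A.A a b
  | _, 0, _ => 0
  | a, b + 1, h => A.dv a b (x ⟨(a, b), by lia⟩)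

/-- The total differential `(-1)^{p+q} ∂ + ∂̄`. -/
def totD (n : ℕ) : A.TotX n →+ A.TotX (n + 1) where
  toFun x i := A.totH x i.1.1 i.1.2 i.2 + A.totV x i.1.1 i.1.2 i.2
  map_zero' := by
    funext ⟨⟨a, b⟩, h⟩
    cases a <;> cases b <;> simp [totH, totV]
  map_add' x y := by
    funext ⟨⟨a, b⟩, h⟩
    cases a <;> cases b <;> simp [totH, totV]; abel

lemma totD_totD (n : ℕ) (x : A.TotX n) : A.totD (n + 1) (A.totD n x) = 0 := by
  funext ⟨⟨a, b⟩, h⟩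
  rcases a with _ | _ | a <;> rcases b with _ | _ | b <;>
    simp [totD, totH, totV, A.dh_dh, A.dv_dv, A.comm, pow_succ]

/-- The total complex. -/
def tot : CochainComplex AddCommGrpCat.{u} ℕ :=
  CochainComplex.of (fun n => AddCommGrpCat.of (A.TotX n)) (fun n => AddCommGrpCat.ofHom (A.totD n))
    fun n => by
    apply AddCommGrpCat.hom_ext
    exact AddMonoidHom.ext fun x => A.totD_totD n x

lemma tot_d (n : ℕ) (x : A.TotX n) : A.tot.d n (n + 1) x = A.totD n x :=
  ConcreteCategory.congr_hom (CochainComplex.of_d (fun n => AddCommGrpCat.of (A.TotX n))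
    (fun n => AddCommGrpCat.ofHom (A.totD n)) n) x

/-- The subgroup `Fⁱ Aⁿ = ⨁_{p+q=n, p ≥ i} A^{p,q}` of `Aⁿ`. -/
def filtSub (i n : ℕ) : AddSubgroup (A.TotX n) where
  carrier := {x | ∀ j, j.1.1 < i → x j = 0}
  zero_mem' := fun _ _ => rfl
  add_mem' := fun {x y} hx hy j hj => by
    change x j + y j = 0
    rw [hx j hj, hy j hj, add_zero]
  neg_mem' := fun {x} hx j hj => by
    change - x j = 0
    rw [hx j hj, neg_zero]

lemma totD_mem_filtSub {i n : ℕ} {x : A.TotX n} (hx : x ∈ A.filtSub i n) :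
    A.totD n x ∈ A.filtSub i (n + 1) := by
  rintro ⟨⟨a, b⟩, h⟩ (hj : a < i)
  have hx' : ∀ a b h, a < i → x ⟨(a, b), h⟩ = 0 := fun a b h h' => hx ⟨(a, b), h⟩ h'
  rcases a with _ | a <;> rcases b with _ | b
  · simp [totD, totH, totV]
  · simp [totD, totH, totV, hx' 0 b (by lia) hj]
  · simp [totD, totH, totV, hx' a 0 (by lia) (by lia)]
  · simp [totD, totH, totV, hx' a (b + 1) (by lia) (by lia), hx' (a + 1) b (by lia) hj]

/-- The total complex with the filtration by the `Fⁱ`. -/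
def filt : FilteredComplex.{u} where
  C := A.tot
  F := A.filtSub
  F_zero _ := eq_top_iff.2 fun _ _ j hj => absurd hj (Nat.not_lt_zero j.1.1)
  anti n h := fun x hx j hj => hx j (hj.trans_le h)
  d_mem {i n x} hx := by
    exact Set.mem_of_eq_of_mem (A.tot_d n x) (A.totD_mem_filtSub hx)

end DoubleComplex
end SpectralSequences

noncomputable section SecondTerm

/-- Cocycles (as elements of the kernel of the differential) mapped to the object of cycles. -/
def kerToCycles (C : CochainComplex AddCommGrpCat.{u} ℕ) (p : ℕ) :
    AddCommGrpCat.of (C.d p (p + 1)).hom.ker ⟶ C.cycles p :=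
  C.liftCycles (AddCommGrpCat.ofHom (C.d p (p + 1)).hom.ker.subtype) (p + 1) (by simp)
    (by apply AddCommGrpCat.hom_ext; exact AddMonoidHom.ext fun x => x.2)

lemma iCycles_kerToCycles (C : CochainComplex AddCommGrpCat.{u} ℕ) (p : ℕ)
    (x : (C.d p (p + 1)).hom.ker) : C.iCycles p (kerToCycles C p x) = x.1 :=
  ConcreteCategory.congr_hom (C.liftCycles_i
    (AddCommGrpCat.ofHom (C.d p (p + 1)).hom.ker.subtype) (p + 1) (by simp)
    (by apply AddCommGrpCat.hom_ext; exact AddMonoidHom.ext fun x => x.2)) x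

/-- The class in `Hᵖ(C)` of a cocycle. -/
def cls (C : CochainComplex AddCommGrpCat.{u} ℕ) (p : ℕ) :
    (C.d p (p + 1)).hom.ker →+ C.homology p :=
  (kerToCycles C p ≫ C.homologyπ p).hom

lemma cls_surjective (C : CochainComplex AddCommGrpCat.{u} ℕ) (p : ℕ) :
    Function.Surjective (cls C p) := by
  intro h
  obtain ⟨c, rfl⟩ := (AddCommGrpCat.epi_iff_surjective (C.homologyπ p)).1 inferInstance h
  refine ⟨⟨C.iCycles p c, ConcreteCategory.congr_hom (C.iCycles_d p (p + 1)) c⟩, ?_⟩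
  refine congrArg (C.homologyπ p) ?_
  apply (AddCommGrpCat.mono_iff_injective (C.iCycles p)).1 inferInstance
  exact iCycles_kerToCycles C p _

/-- The coboundaries of degree `p`. -/
def cobound (C : CochainComplex AddCommGrpCat.{u} ℕ) : ∀ p, AddSubgroup (C.X p)
  | 0 => ⊥
  | p + 1 => (C.d p (p + 1)).hom.range

lemma cls_eq_zero_iff (C : CochainComplex AddCommGrpCat.{u} ℕ) (p : ℕ)
    (x : (C.d p (p + 1)).hom.ker) : cls C p x = 0 ↔ x.1 ∈ cobound C p := by
  set c := kerToCycles C p x with hc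
  have hcx : C.iCycles p c = x.1 := iCycles_kerToCycles C p x
  have hinj := (AddCommGrpCat.mono_iff_injective (C.iCycles p)).1 inferInstance
  change C.homologyπ p c = 0 ↔ _
  have hex (i : ℕ) (hi : (ComplexShape.up ℕ).prev p = i) :
      C.homologyπ p c = 0 ↔ ∃ y, C.d i p y = x.1 := by
    have h := (ShortComplex.ab_exact_iff _).1
      (ShortComplex.exact_of_g_is_cokernel (ShortComplex.mk _ _ (C.toCycles_comp_homologyπ i p))
        (C.homologyIsCokernel i p hi)) c
    constructor
    · intro h0
      obtain ⟨y, hy⟩ := h h0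
      refine ⟨y, ?_⟩
      rw [← hcx, ← C.toCycles_i i p]
      exact congrArg (C.iCycles p) hy
    · rintro ⟨y, hy⟩
      have : c = C.toCycles i p y := hinj (by
        rw [hcx, ← hy]
        exact (ConcreteCategory.congr_hom (C.toCycles_i i p) y).symm)
      rw [this]
      exact ConcreteCategory.congr_hom (C.toCycles_comp_homologyπ i p) y
  rcases p with _ | p
  · rw [hex 0 CochainComplex.prev_nat_zero, C.shape 0 0 (by simp)]
    exact ⟨fun ⟨y, hy⟩ => hy.symm, fun h => ⟨0, h.symm⟩⟩
  · rw [hex p (CochainComplex.prev_nat_succ p)]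
    rfl

namespace DoubleComplex

variable (A : DoubleComplex.{u})

/-- The image of `∂̄ : A^{p,q-1} → A^{p,q}`. -/
def dvRange (p : ℕ) : ∀ q, AddSubgroup (A.A p q)
  | 0 => ⊥
  | q + 1 => (A.dv p q).range

/-- A presentation of the complex `p ↦ H^q_{∂̄}(A^{p,*})`: a complex `H` together with, for each
`p`, a group `Z p` identified by `ι` with the `∂̄`-cocycles in `A^{p,q}` and a surjection `π`
from `Z p` to `Hᵖ` whose kernel consists of the `∂̄`-coboundaries. -/
structure RowCohomology (q : ℕ) where
  /-- the `∂̄`-cocycles -/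
  Z : ℕ → AddCommGrpCat.{u}
  /-- the inclusion of the cocycles -/
  ι : ∀ p, Z p →+ A.A p q
  /-- the differential `∂` on cocycles -/
  dZ : ∀ p, Z p → Z (p + 1)
  /-- the complex of cohomology groups with differential induced by `∂` -/
  H : CochainComplex AddCommGrpCat.{u} ℕ
  /-- the projection to cohomology -/
  π : ∀ p, Z p →+ H.X p
  ι_dZ : ∀ p z, ι (p + 1) (dZ p z) = A.dh p q (ι p z)
  π_dZ : ∀ p z, π (p + 1) (dZ p z) = H.d p (p + 1) (π p z)
  ι_injective : ∀ p, Function.Injective (ι p)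
  dv_ι : ∀ p z, A.dv p q (ι p z) = 0
  exists_ι : ∀ p x, A.dv p q x = 0 → ∃ z, ι p z = x
  π_surjective : ∀ p, Function.Surjective (π p)
  π_eq_zero_iff : ∀ p z, π p z = 0 ↔ ι p z ∈ A.dvRange p q

variable {A}

lemma mem_Z_two {p n : ℕ} {x : A.TotX n} (hx : x ∈ A.filt.Z 2 p n) :
    (∀ a b h, a < p → x ⟨(a, b), h⟩ = 0) ∧
    (∀ a b h, a < p + 2 → A.totD n x ⟨(a, b), h⟩ = 0) := by
  refine ⟨fun a b h ha => hx.1 ⟨(a, b), h⟩ ha, fun a b h ha => ?_⟩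
  have h2 : A.totD n x ∈ A.filtSub (p + 2) (n + 1) :=
    Set.mem_of_eq_of_mem (A.tot_d n x).symm hx.2
  exact h2 ⟨(a, b), h⟩ ha

lemma dv_eq_zero {p q n : ℕ} (hn : p + q = n) {x : A.TotX n} (hx : x ∈ A.filt.Z 2 p n) :
    A.dv p q (x ⟨(p, q), hn⟩) = 0 := by
  obtain ⟨h1, h2⟩ := mem_Z_two hx
  have h := h2 p (q + 1) (by lia) (by lia)
  rcases p with _ | p
  · simpa [totD, totH, totV] using h
  · simpa [totD, totH, totV, h1 p (q + 1) (by lia) (by lia)] using h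

lemma dh_mem {p q n : ℕ} (hn : p + q = n) {x : A.TotX n} (hx : x ∈ A.filt.Z 2 p n) :
    A.dh p q (x ⟨(p, q), hn⟩) ∈ A.dvRange (p + 1) q := by
  obtain ⟨h1, h2⟩ := mem_Z_two hx
  have h := h2 (p + 1) q (by lia) (by lia)
  have hs : ((-1 : ℤ) ^ n) * (-1) ^ n = 1 := by rw [← mul_pow]; simp
  rcases q with _ | q
  · have h' : (-1 : ℤ) ^ n • A.dh p 0 (x ⟨(p, 0), hn⟩) = 0 := by
      simpa [totD, totH, totV] using h
    have := congrArg ((-1 : ℤ) ^ n • ·) h'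
    simp only [smul_smul, hs, one_smul, smul_zero] at this
    exact this
  · have h' : (-1 : ℤ) ^ n • A.dh p (q + 1) (x ⟨(p, q + 1), hn⟩) +
        A.dv (p + 1) q (x ⟨(p + 1, q), by lia⟩) = 0 := h
    refine ⟨-((-1 : ℤ) ^ n • x ⟨(p + 1, q), by lia⟩), ?_⟩
    rw [map_neg, map_zsmul, ← smul_neg, ← eq_neg_of_add_eq_zero_left h', smul_smul, hs, one_smul]

/-- The element of `Aⁿ` with the single component `v` in bidegree `(a, b)`. -/
def single {n : ℕ} (a b : ℕ) (h : a + b = n) : A.A a b →+ A.TotX n :=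
  AddMonoidHom.single (fun i : {i : ℕ × ℕ // i.1 + i.2 = n} => A.A i.1.1 i.1.2) ⟨(a, b), h⟩

lemma single_same {n : ℕ} (a b : ℕ) (h : a + b = n) (v : A.A a b) :
    single a b h v ⟨(a, b), h⟩ = v := Pi.single_eq_same _ _

lemma single_ne {n : ℕ} (a b : ℕ) (h : a + b = n) (v : A.A a b) {c d : ℕ} (h' : c + d = n)
    (hne : c ≠ a) : single a b h v ⟨(c, d), h'⟩ = 0 :=
  Pi.single_eq_of_ne (by intro e; exact hne (congrArg (fun i => i.1.1) e)) _

lemma single_mem {n : ℕ} (a b : ℕ) (h : a + b = n) (v : A.A a b) {i : ℕ} (hi : i ≤ a) :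
    single a b h v ∈ A.filtSub i n := by
  rintro ⟨⟨c, d⟩, h'⟩ (hj : c < i)
  exact single_ne a b h v h' (by lia)

lemma totD_single {n : ℕ} (a b : ℕ) (h : a + b = n) (v : A.A a b) :
    A.totD n (single a b h v) = (-1 : ℤ) ^ n • single (a + 1) b (by lia) (A.dh a b v) +
      single a (b + 1) (by lia) (A.dv a b v) := by
  funext ⟨⟨c, d⟩, h'⟩
  change A.totH (single a b h v) c d h' + A.totV (single a b h v) c d h' =
    (-1 : ℤ) ^ n • single (a + 1) b (by lia) (A.dh a b v) ⟨(c, d), h'⟩ +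
      single a (b + 1) (by lia) (A.dv a b v) ⟨(c, d), h'⟩
  congr 1
  · rcases c with _ | c
    · rw [single_ne _ _ _ _ _ (by lia), smul_zero]; rfl
    · change (-1 : ℤ) ^ n • A.dh c d (single a b h v ⟨(c, d), by lia⟩) = _
      by_cases hc : c = a
      · subst hc
        obtain rfl : d = b := by lia
        rw [single_same, single_same]
      · rw [single_ne _ _ _ _ _ hc, single_ne _ _ _ _ _ (by lia), map_zero]
  · rcases d with _ | d
    · rw [single_ne _ _ _ _ _ (by lia)]; rfl
    · change A.dv c d (single a b h v ⟨(c, d), by lia⟩) = _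
      by_cases hc : c = a
      · subst hc
        obtain rfl : d = b := by lia
        rw [single_same, single_same]
      · rw [single_ne _ _ _ _ _ hc, single_ne _ _ _ _ _ hc, map_zero]

lemma mem_Z_of {r i n : ℕ} {x : A.TotX n} (h1 : x ∈ A.filtSub i n)
    (h2 : A.totD n x ∈ A.filtSub (i + r) (n + 1)) : x ∈ A.filt.Z r i n :=
  ⟨h1, (Set.mem_of_eq_of_mem (A.tot_d n x) h2 :
    A.tot.d n (n + 1) x ∈ A.filtSub (i + r) (n + 1))⟩

lemma mem_succ {p q n : ℕ} (hn : p + q = n) {x : A.TotX n} (hx : x ∈ A.filtSub p n)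
    (h0 : x ⟨(p, q), hn⟩ = 0) : x ∈ A.filtSub (p + 1) n := by
  rintro ⟨⟨a, b⟩, h⟩ (hj : a < p + 1)
  rcases Nat.lt_succ_iff_lt_or_eq.1 hj with h' | rfl
  · exact hx ⟨(a, b), h⟩ h'
  · obtain rfl : b = q := by lia
    exact h0

lemma mem_B_of {p q m : ℕ} (hn : p + q = m + 1) {x : A.TotX (m + 1)}
    (hx : x ∈ A.filt.Z 2 p (m + 1)) {y : A.TotX m} (hy : y ∈ A.filtSub (p + 1 - 2) m)
    (hDy : A.totD m y ∈ A.filtSub p (m + 1))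
    (hxy : A.totD m y ⟨(p, q), hn⟩ = x ⟨(p, q), hn⟩) : x ∈ A.filt.B 2 p (m + 1) := by
  have e : A.totD m y + (x - A.totD m y) = x := add_sub_cancel _ _
  have hz : x - A.totD m y ∈ A.filtSub (p + 1) (m + 1) := by
    refine mem_succ hn ((A.filtSub p (m + 1)).sub_mem hx.1 hDy) ?_
    change x _ - A.totD m y _ = 0
    rw [hxy, sub_self]
  refine AddSubgroup.mem_sup.2 ⟨A.totD m y, ⟨⟨y, hy, A.tot_d m y⟩, hDy⟩, x - A.totD m y,
    ⟨hz, ?_⟩, e⟩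
  refine (mem_Z_of (r := 1) hz ?_).2
  rw [map_sub, A.totD_totD, sub_zero]
  exact Set.mem_of_eq_of_mem (A.tot_d _ x).symm hx.2

namespace RowCohomology

variable {q : ℕ} (R : A.RowCohomology q)

/-- For `x ∈ Z_2^{p,q}`, the leading component `x_{p,q}` seen as a cocycle. -/
def lead {p n : ℕ} (hn : p + q = n) : A.filt.Z 2 p n →+ R.Z p where
  toFun x := (R.exists_ι p _ (dv_eq_zero hn x.2)).choose
  map_zero' := by
    apply R.ι_injective
    rw [(R.exists_ι p _ (dv_eq_zero hn (A.filt.Z 2 p n).zero_mem)).choose_spec, map_zero]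
    rfl
  map_add' x y := by
    apply R.ι_injective
    rw [(R.exists_ι p _ (dv_eq_zero hn (x + y).2)).choose_spec, map_add,
      (R.exists_ι p _ (dv_eq_zero hn x.2)).choose_spec,
      (R.exists_ι p _ (dv_eq_zero hn y.2)).choose_spec]
    rfl

lemma ι_lead {p n : ℕ} (hn : p + q = n) (x : A.filt.Z 2 p n) :
    R.ι p (R.lead hn x) = (x.1 : A.TotX n) ⟨(p, q), hn⟩ :=
  (R.exists_ι p _ (dv_eq_zero hn x.2)).choose_spec

lemma d_lead {p n : ℕ} (hn : p + q = n) (x : A.filt.Z 2 p n) :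
    R.H.d p (p + 1) (R.π p (R.lead hn x)) = 0 := by
  rw [← R.π_dZ, R.π_eq_zero_iff, R.ι_dZ, ι_lead]
  exact dh_mem hn x.2

/-- The map `Z_2^{p,q} → Hᵖ(H)` sending `x` to the class of the class of `x_{p,q}`. -/
def fromZ {p n : ℕ} (hn : p + q = n) : A.filt.Z 2 p n →+ R.H.homology p :=
  (cls R.H p).comp (((R.π p).comp (R.lead hn)).codRestrict _ (R.d_lead hn))

lemma fromZ_surjective {p n : ℕ} (hn : p + q = n) : Function.Surjective (R.fromZ hn) := by
  have hs : ((-1 : ℤ) ^ n) * (-1) ^ n = 1 := by rw [← mul_pow]; simp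
  intro h
  obtain ⟨⟨w, hw⟩, rfl⟩ := cls_surjective R.H p h
  obtain ⟨z, rfl⟩ := R.π_surjective p w
  have hw' : R.π (p + 1) (R.dZ p z) = 0 := (R.π_dZ p z).trans hw
  rw [R.π_eq_zero_iff, R.ι_dZ] at hw'
  suffices h : ∃ x : A.TotX n, x ∈ A.filtSub p n ∧ A.totD n x ∈ A.filtSub (p + 2) (n + 1) ∧
      x ⟨(p, q), hn⟩ = R.ι p z by
    obtain ⟨x, hx1, hx2, hxz⟩ := h
    refine ⟨⟨x, mem_Z_of hx1 hx2⟩, ?_⟩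
    refine congrArg (cls R.H p) (Subtype.ext ?_)
    refine congrArg (R.π p) (R.ι_injective p ?_)
    rw [ι_lead, ← hxz]
  have hdv := R.dv_ι p z
  rcases q with _ | q
  · refine ⟨single p 0 hn (R.ι p z), single_mem _ _ _ _ le_rfl, ?_, single_same _ _ _ _⟩
    have : A.dh p 0 (R.ι p z) = 0 := hw'
    rw [totD_single, this, hdv, map_zero, map_zero, smul_zero, add_zero]
    exact zero_mem _
  · obtain ⟨v, hv⟩ := hw'
    refine ⟨single p (q + 1) hn (R.ι p z) - (-1 : ℤ) ^ n • single (p + 1) q (by lia) v,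
      sub_mem (single_mem _ _ _ _ le_rfl)
        (zsmul_mem (single_mem _ _ _ _ (by lia)) _), ?_, ?_⟩
    · rw [map_sub, map_zsmul, totD_single, totD_single, hdv, hv, map_zero, add_zero, smul_add,
        smul_smul, hs, one_smul, sub_add_cancel_right]
      exact neg_mem (single_mem _ _ _ _ (by lia))
    · change single p (q + 1) hn (R.ι p z) _ -
        (-1 : ℤ) ^ n • single (p + 1) q (by lia) v ⟨(p, q + 1), hn⟩ = _
      rw [single_same, single_ne _ _ _ _ _ (by lia), smul_zero, sub_zero]

lemma fromZ_eq_zero_iff {p n : ℕ} (hn : p + q = n) (x : A.filt.Z 2 p n) :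
    R.fromZ hn x = 0 ↔ R.π p (R.lead hn x) ∈ cobound R.H p :=
  cls_eq_zero_iff _ _ _

lemma fromZ_eq_zero_of_mem {p n : ℕ} (hn : p + q = n) (x : A.filt.Z 2 p n)
    (hx : x.1 ∈ A.filt.B 2 p n) : R.fromZ hn x = 0 := by
  rw [fromZ_eq_zero_iff]
  obtain ⟨_, ⟨⟨y, hy, rfl⟩, hb⟩, z, hz, e⟩ := AddSubgroup.mem_sup.1 hx
  have hz0 : (z : A.TotX n) ⟨(p, q), hn⟩ = 0 := hz.1 _ (Nat.lt_succ_self p)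
  rcases n with _ | m
  · have hb0 : A.filt.C.d 0 0 y = 0 := by rw [A.filt.C.shape 0 0 (by simp)]; rfl
    have e0 : R.lead hn x = 0 := R.ι_injective p (by
      rw [ι_lead, map_zero, ← e]
      have : (A.filt.C.d 0 0 y + z : A.TotX 0) ⟨(p, q), hn⟩ = 0 := by
        rw [hb0, zero_add]; exact hz0
      exact this)
    rw [e0, map_zero]
    exact zero_mem _
  · have hy' : (y : A.TotX m) ∈ A.filtSub (p + 1 - 2) m := hy
    have hDy : A.totD m y ∈ A.filtSub p (m + 1) := Set.mem_of_eq_of_mem (A.tot_d m y).symm hb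
    have e1 : R.ι p (R.lead hn x) = A.totD m y ⟨(p, q), hn⟩ := by
      rw [ι_lead, ← e]
      change A.tot.d m (m + 1) y ⟨(p, q), hn⟩ + (z : A.TotX (m + 1)) ⟨(p, q), hn⟩ = _
      rw [hz0, add_zero]
      exact congrFun (A.tot_d m y) _
    have hV : ∀ a b h, A.totV (y : A.TotX m) a b h ∈ A.dvRange a b := by
      intro a b h
      rcases b with _ | b
      · exact zero_mem _
      · exact ⟨_, rfl⟩
    rcases p with _ | p
    · refine (R.π_eq_zero_iff 0 _).2 ?_
      rw [e1]
      have : A.totD m y ⟨(0, q), hn⟩ = A.totV (y : A.TotX m) 0 q hn := zero_add _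
      rw [this]
      exact hV _ _ _
    · have hu : A.dv p q ((y : A.TotX m) ⟨(p, q), by lia⟩) = 0 := by
        have h := hDy ⟨(p, q + 1), by lia⟩ (Nat.lt_succ_self p)
        have h' : A.totH (y : A.TotX m) p (q + 1) (by lia) = 0 := by
          rcases p with _ | p
          · rfl
          · have : (y : A.TotX m) ⟨(p, q + 1), by lia⟩ = 0 := hy' _ (by
              change p < p + 1 + 1 + 1 - 2
              lia)
            change (-1 : ℤ) ^ m • A.dh p (q + 1) ((y : A.TotX m) ⟨(p, q + 1), by lia⟩) = 0
            rw [this, map_zero, smul_zero]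
        change A.totH (y : A.TotX m) p (q + 1) _ + _ = 0 at h
        rw [h', zero_add] at h
        exact h
      obtain ⟨u, hu⟩ := R.exists_ι p _ hu
      have h2 : R.π (p + 1) (R.lead hn x - (-1 : ℤ) ^ m • R.dZ p u) = 0 := by
        rw [R.π_eq_zero_iff, map_sub, map_zsmul, R.ι_dZ, e1, hu]
        have : A.totD m y ⟨(p + 1, q), hn⟩ =
          (-1 : ℤ) ^ m • A.dh p q ((y : A.TotX m) ⟨(p, q), by lia⟩) +
            A.totV (y : A.TotX m) (p + 1) q hn := rfl
        rw [this, add_sub_cancel_left]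
        exact hV _ _ _
      rw [map_sub, map_zsmul, R.π_dZ, sub_eq_zero] at h2
      rw [h2]
      exact zsmul_mem (⟨_, rfl⟩ : _ ∈ (R.H.d p (p + 1)).hom.range) _

lemma mem_of_fromZ_eq_zero {p n : ℕ} (hn : p + q = n) (x : A.filt.Z 2 p n)
    (hx : R.fromZ hn x = 0) : x.1 ∈ A.filt.B 2 p n := by
  rw [fromZ_eq_zero_iff] at hx
  obtain ⟨x, hx'⟩ := x
  change x ∈ _
  have key0 : (x : A.TotX n) ⟨(p, q), hn⟩ = 0 → x ∈ A.filt.B 2 p n := fun h =>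
    AddSubgroup.mem_sup_right ⟨mem_succ hn hx'.1 h, hx'.2⟩
  have el : R.ι p (R.lead hn ⟨x, hx'⟩) = (x : A.TotX n) ⟨(p, q), hn⟩ := R.ι_lead hn ⟨x, hx'⟩
  rcases p with _ | p
  · have h := (R.π_eq_zero_iff 0 _).1 hx
    rw [el] at h
    rcases q with _ | q
    · exact key0 h
    · obtain ⟨v, hv⟩ := h
      obtain ⟨m, rfl⟩ : ∃ m, n = m + 1 := ⟨q, by lia⟩
      refine mem_B_of hn hx' (y := single 0 q (by lia) v) (single_mem _ _ _ _ (by lia))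
        (fun j hj => absurd hj (Nat.not_lt_zero _)) ?_
      rw [totD_single]
      refine Eq.trans ?_ hv
      rw [Pi.add_apply, Pi.smul_apply, single_same, single_ne _ _ _ _ _ (by lia), smul_zero, zero_add]
  · obtain ⟨w, hw⟩ := hx
    obtain ⟨u, rfl⟩ := R.π_surjective p w
    obtain ⟨m, rfl⟩ : ∃ m, n = m + 1 := ⟨p + q, by lia⟩
    have hs : ((-1 : ℤ) ^ m) * (-1) ^ m = 1 := by rw [← mul_pow]; simp
    have h : R.ι (p + 1) (R.lead hn ⟨x, hx'⟩) - A.dh p q (R.ι p u) ∈ A.dvRange (p + 1) q := by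
      rw [← R.ι_dZ, ← map_sub, ← R.π_eq_zero_iff, map_sub, R.π_dZ, sub_eq_zero]
      exact hw.symm
    rw [el] at h
    have hD : A.totD m ((-1 : ℤ) ^ m • single p q (by lia) (R.ι p u)) =
        single (p + 1) q hn (A.dh p q (R.ι p u)) := by
      rw [map_zsmul, totD_single, R.dv_ι, map_zero, add_zero, smul_smul, hs, one_smul]
    rcases q with _ | q
    · refine mem_B_of hn hx' (y := (-1 : ℤ) ^ m • single p 0 (by lia) (R.ι p u))
        (zsmul_mem (single_mem _ _ _ _ (by lia)) _) ?_ ?_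
      · rw [hD]; exact single_mem _ _ _ _ le_rfl
      · rw [hD, single_same]
        exact (sub_eq_zero.1 h).symm
    · obtain ⟨v, hv⟩ := h
      refine mem_B_of hn hx' (y := (-1 : ℤ) ^ m • single p (q + 1) (by lia) (R.ι p u) +
        single (p + 1) q (by lia) v)
        (add_mem (zsmul_mem (single_mem _ _ _ _ (by lia)) _) (single_mem _ _ _ _ (by lia))) ?_ ?_
      · rw [map_add, hD, totD_single]
        exact add_mem (single_mem _ _ _ _ le_rfl) (add_mem (zsmul_mem (single_mem _ _ _ _ (by lia)) _)
          (single_mem _ _ _ _ le_rfl))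
      · rw [map_add, hD, totD_single]
        rw [Pi.add_apply, Pi.add_apply, Pi.smul_apply, single_same, single_same, single_ne _ _ _ _ _ (by lia), smul_zero, zero_add]
        have hv' : A.dv (p + 1) q v = _ := hv
        rw [hv', add_sub_cancel]

/-- The identification `E_2^{p,q} ≃ Hᵖ(H)`, sending the class of `x ∈ Z_2^{p,q}` to the class of
the class of `x_{p,q}`. -/
def equivE {p n : ℕ} (hn : p + q = n) : A.filt.E 2 p n ≃+ R.H.homology p :=
  AddEquiv.ofBijective
    (QuotientAddGroup.lift ((A.filt.B 2 p n).addSubgroupOf (A.filt.Z 2 p n)) (R.fromZ hn)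
      fun x hx => R.fromZ_eq_zero_of_mem hn x hx) <| by
    constructor
    · rw [injective_iff_map_eq_zero]
      intro e he
      obtain ⟨x, rfl⟩ := QuotientAddGroup.mk_surjective e
      exact (QuotientAddGroup.eq_zero_iff x).2 (R.mem_of_fromZ_eq_zero hn x he)
    · intro h
      obtain ⟨x, rfl⟩ := R.fromZ_surjective hn h
      exact ⟨QuotientAddGroup.mk x, rfl⟩

lemma equivE_mk {p n : ℕ} (hn : p + q = n) (x : A.filt.Z 2 p n) :
    R.equivE hn (QuotientAddGroup.mk x) = R.fromZ hn x := rfl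

end RowCohomology
end DoubleComplex
end SecondTerm

noncomputable section LeraySS

variable {X Y M N : TopCat.{u}}

/-- The double complex `A^{p,q} = Γ(X, 𝒜ᵖ(K^q))` attached to a complex of sheaves `K`. -/
def canDouble (K : CochainComplex (AbSheaf X) ℕ) : DoubleComplex.{u} where
  A p q := (canΓ X p).obj (K.X q)
  dh p q := ((sections X).map ((canD X p).app (K.X q))).hom
  dv p q := ((canΓ X p).map (K.d q (q + 1))).hom
  dh_dh p q x := by
    have h := congrArg (sections X).map (canD_comp p (K.X q))
    rw [Functor.map_comp, Functor.map_zero] at h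
    exact ConcreteCategory.congr_hom h x
  dv_dv p q x := by
    have h := congrArg (canΓ X p).map (K.d_comp_d q (q + 1) (q + 2))
    rw [Functor.map_comp, Functor.map_zero] at h
    exact ConcreteCategory.congr_hom h x
  comm p q x := by
    have h := congrArg (sections X).map ((canD X p).naturality (K.d q (q + 1)))
    rw [Functor.map_comp, Functor.map_comp] at h
    exact ConcreteCategory.congr_hom h x

/-- The complex `Γ(X, 𝒜^*(F))`. -/
abbrev canComplex (F : AbSheaf X) : CochainComplex AddCommGrpCat.{u} ℕ :=
  ((sections X).mapHomologicalComplex _).obj ((canRes X).obj F)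

lemma canComplex_d (F : AbSheaf X) (p : ℕ) :
    (canComplex F).d p (p + 1) = (sections X).map ((canD X p).app F) :=
  congrArg (sections X).map (canResObj_d F p)

/-- Since `Γ(X, 𝒜ᵖ(-))` is exact, the `∂̄`-cohomology of the double complex attached to `K` is
`Γ(X, 𝒜ᵖ(H^q(K)))`. -/
def canRow (K : CochainComplex (AbSheaf X) ℕ) (q : ℕ) : (canDouble K).RowCohomology q where
  Z p := (canΓ X p).obj (K.cycles q)
  ι p := ((canΓ X p).map (K.iCycles q)).hom
  dZ p := (sections X).map ((canD X p).app (K.cycles q))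
  H := canComplex (K.homology q)
  π p := ((canΓ X p).map (K.homologyπ q)).hom
  ι_dZ p z := by
    have h := congrArg (sections X).map ((canD X p).naturality (K.iCycles q))
    rw [Functor.map_comp, Functor.map_comp] at h
    exact (ConcreteCategory.congr_hom h z).symm
  π_dZ p z := by
    have h := congrArg (sections X).map ((canD X p).naturality (K.homologyπ q))
    rw [Functor.map_comp, Functor.map_comp] at h
    rw [canComplex_d]
    exact (ConcreteCategory.congr_hom h z).symm
  ι_injective p := canΓ_injective p (K.iCycles q)
  dv_ι p z := by
    have h := congrArg (canΓ X p).map (K.iCycles_d q (q + 1))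
    rw [Functor.map_comp, Functor.map_zero] at h
    exact ConcreteCategory.congr_hom h z
  exists_ι p x hx :=
    (ShortComplex.ab_exact_iff _).1 (canΓ_exact p (ShortComplex.exact_of_f_is_kernel
      (ShortComplex.mk _ _ (K.iCycles_d q (q + 1))) (K.cyclesIsKernel q (q + 1) (by simp)))) x hx
  π_surjective p := canΓ_surjective p (K.homologyπ q)
  π_eq_zero_iff p z := by
    have hinj := canΓ_injective p (K.iCycles q)
    have hex (i : ℕ) (hi : (ComplexShape.up ℕ).prev q = i) :
        (canΓ X p).map (K.homologyπ q) z = 0 ↔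
          ∃ y, (canΓ X p).map (K.d i q) y = (canΓ X p).map (K.iCycles q) z := by
      have h := (ShortComplex.ab_exact_iff _).1 (canΓ_exact p
        (ShortComplex.exact_of_g_is_cokernel (ShortComplex.mk _ _ (K.toCycles_comp_homologyπ i q))
          (K.homologyIsCokernel i q hi))) z
      have e := congrArg (canΓ X p).map (K.toCycles_i i q)
      have e0 := congrArg (canΓ X p).map (K.toCycles_comp_homologyπ i q)
      rw [Functor.map_comp] at e e0
      rw [Functor.map_zero] at e0
      constructor
      · intro h0
        obtain ⟨y, hy⟩ := h h0
        exact ⟨y, (ConcreteCategory.congr_hom e y).symm.trans (congrArg ((canΓ X p).map (K.iCycles q)) hy)⟩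
      · rintro ⟨y, hy⟩
        have : z = (canΓ X p).map (K.toCycles i q) y :=
          hinj (hy.symm.trans (ConcreteCategory.congr_hom e y).symm)
        rw [this]
        exact ConcreteCategory.congr_hom e0 y
    rcases q with _ | q
    · refine (hex 0 CochainComplex.prev_nat_zero).trans ?_
      rw [K.shape 0 0 (by simp), Functor.map_zero]
      exact ⟨fun ⟨y, hy⟩ => hy.symm, fun h => ⟨0, h.symm⟩⟩
    · exact hex q (CochainComplex.prev_nat_succ q)

/-- The identification `E_2^{p,q} ≃ Hᵖ(X, H^q(K))` (with `n = p + q`). -/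
def equivE₂ (K : CochainComplex (AbSheaf X) ℕ) {p q n : ℕ} (hn : p + q = n) :
    (canDouble K).filt.E 2 p n ≃+ (cohomology X p).obj (K.homology q) :=
  (canRow K q).equivE hn

/-- The double complex `A^{p,q} = Γ(N, 𝒜ᵖ(f_* 𝒜^q(S)))`. -/
def lerayDouble (f : M ⟶ N) (S : AbSheaf M) : DoubleComplex.{u} :=
  canDouble ((directImageComplex f).obj S)

/-- The identification `E_2^{p,q} ≃ Hᵖ(N, R^q f_* S)` (with `n = p + q`) of the second term of the
Leray spectral sequence. -/
def lerayEquiv (f : M ⟶ N) (S : AbSheaf M) {p q n : ℕ} (hn : p + q = n) :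
    (lerayDouble f S).filt.E 2 p n ≃+ (cohomology N p).obj ((higherDirectImage f q).obj S) :=
  equivE₂ _ hn

/-- The differential `d_2 : Hᵖ(N, R^{q+1} f_* S) → H^{p+2}(N, R^q f_* S)` of the Leray spectral
sequence. -/
def lerayD₂ (f : M ⟶ N) (S : AbSheaf M) (p q : ℕ) :
    (cohomology N p).obj ((higherDirectImage f (q + 1)).obj S) ⟶
      (cohomology N (p + 2)).obj ((higherDirectImage f q).obj S) :=
  AddCommGrpCat.ofHom <|
    ((lerayEquiv f S (p := p + 2) (q := q) (n := p + (q + 1) + 1) (by lia)).toAddMonoidHom.comp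
      ((lerayDouble f S).filt.d 2 p (p + (q + 1)))).comp
      (lerayEquiv f S (p := p) (q := q + 1) rfl).symm.toAddMonoidHom

end LeraySS

noncomputable section Comap

variable {X Y : TopCat.{u}} (g : X ⟶ Y)

/-- The direct image functor on abelian sheaves. -/
abbrev push (g : X ⟶ Y) : AbSheaf X ⥤ AbSheaf Y := TopCat.Sheaf.pushforward AddCommGrpCat.{u} g

/-- A morphism `k : F ⟶ g_* F'` induces homomorphisms of stalks `F_{g(x)} → F'_x`. -/
def stalkComap {F : AbSheaf Y} {F' : AbSheaf X} (k : F ⟶ (push g).obj F') (x : X) :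
    F.presheaf.stalk (g x) →+ F'.presheaf.stalk x :=
  (F'.presheaf.stalkPushforward _ g x).hom.comp (stalkMap (g x) k)

lemma stalkComap_germ {F : AbSheaf Y} {F' : AbSheaf X} (k : F ⟶ (push g).obj F') (x : X)
    (U : Opens Y) (hx : g x ∈ U) (s : F.presheaf.obj (op U)) :
    stalkComap g k x (F.presheaf.germ U (g x) hx s) =
      F'.presheaf.germ ((Opens.map g).obj U) x hx (k.hom.app (op U) s) :=
  (congrArg (F'.presheaf.stalkPushforward _ g x) (stalkMap_germ (g x) k U hx s)).trans
    (ConcreteCategory.congr_hom (TopCat.Presheaf.stalkPushforward_germ _ g F'.presheaf U x hx) _)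

/-- The morphism `𝒜⁰(F) ⟶ g_* 𝒜⁰(F')` induced by `k : F ⟶ g_* F'`. -/
def discComap {F : AbSheaf Y} {F' : AbSheaf X} (k : F ⟶ (push g).obj F') :
    (disc Y).obj F ⟶ (push g).obj ((disc X).obj F') := ⟨{
  app := fun U => AddCommGrpCat.ofHom (X := ∀ y : U.unop, F.presheaf.stalk (y : Y))
    (Y := ∀ x : (Opens.map g).obj U.unop, F'.presheaf.stalk (x : X))
    { toFun := fun s x => stalkComap g k x (s ⟨g x, x.2⟩)
      map_zero' := by ext x; exact map_zero _
      map_add' := fun s t => by ext x; exact map_add _ _ _ }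
  naturality := fun _ _ _ => rfl }⟩

lemma toDisc_discComap {F : AbSheaf Y} {F' : AbSheaf X} (k : F ⟶ (push g).obj F') :
    (toDisc Y).app F ≫ discComap g k = k ≫ (push g).map ((toDisc X).app F') :=
  AbSheaf.hom_ext fun U s => funext fun x => stalkComap_germ g k x.1 U.unop x.2 s

/-- The morphism `ℬ¹(F) ⟶ g_* ℬ¹(F')` induced by `k : F ⟶ g_* F'`. -/
def quotComap {F : AbSheaf Y} {F' : AbSheaf X} (k : F ⟶ (push g).obj F') :
    (discQuot Y).obj F ⟶ (push g).obj ((discQuot X).obj F') :=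
  cokernel.desc ((toDisc Y).app F) (discComap g k ≫ (push g).map ((discProj X).app F')) (by
    have h : (toDisc X).app F' ≫ (discProj X).app F' = 0 := cokernel.condition _
    rw [← Category.assoc, toDisc_discComap, Category.assoc, ← Functor.map_comp, h,
      Functor.map_zero, comp_zero])

lemma discProj_quotComap {F : AbSheaf Y} {F' : AbSheaf X} (k : F ⟶ (push g).obj F') :
    (discProj Y).app F ≫ quotComap g k = discComap g k ≫ (push g).map ((discProj X).app F') :=
  cokernel.π_desc _ _ _

/-- The morphism `ℬᵖ(F) ⟶ g_* ℬᵖ(F')` induced by `k : F ⟶ g_* F'`. -/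
def canBComap {F : AbSheaf Y} {F' : AbSheaf X} (k : F ⟶ (push g).obj F') :
    ∀ p : ℕ, (canB Y p).obj F ⟶ (push g).obj ((canB X p).obj F')
  | 0 => k
  | p + 1 => quotComap g (canBComap k p)

/-- The morphism `𝒜ᵖ(F) ⟶ g_* 𝒜ᵖ(F')` induced by `k : F ⟶ g_* F'`. -/
def canAComap {F : AbSheaf Y} {F' : AbSheaf X} (k : F ⟶ (push g).obj F') (p : ℕ) :
    (canA Y p).obj F ⟶ (push g).obj ((canA X p).obj F') :=
  discComap g (canBComap g k p)

lemma canAComap_comm {F : AbSheaf Y} {F' : AbSheaf X} (k : F ⟶ (push g).obj F') (p : ℕ) :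
    canAComap g k p ≫ (push g).map ((canD X p).app F') =
      (canD Y p).app F ≫ canAComap g k (p + 1) := by
  have h (F : AbSheaf Y) (F' : AbSheaf X) (k : F ⟶ (push g).obj F') :
      discComap g k ≫ (push g).map
        ((discProj X).app F' ≫ (toDisc X).app ((discQuot X).obj F')) =
      ((discProj Y).app F ≫ (toDisc Y).app ((discQuot Y).obj F)) ≫
        discComap g (quotComap g k) := by
    rw [Category.assoc, toDisc_discComap, Functor.map_comp, ← Category.assoc,
      ← discProj_quotComap, Category.assoc]
  exact h _ _ (canBComap g k p)

/-- The morphism of complexes `𝒜^*(F) ⟶ g_* 𝒜^*(F')` induced by `k : F ⟶ g_* F'`. -/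
def canResComap {F : AbSheaf Y} {F' : AbSheaf X} (k : F ⟶ (push g).obj F') :
    (canRes Y).obj F ⟶ ((push g).mapHomologicalComplex _).obj ((canRes X).obj F') :=
  CochainComplex.ofHom (fun p => canAComap g k p) fun p => by
    have h1 : ((canRes Y).obj F).d p (p + 1) = (canD Y p).app F := canResObj_d F p
    have h2 : (((push g).mapHomologicalComplex (.up ℕ)).obj ((canRes X).obj F')).d p (p + 1) =
      (push g).map ((canD X p).app F') := congrArg (push g).map (canResObj_d F' p)
    rw [h1, h2]
    exact canAComap_comm g k p

/-! Naturality. -/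

section Naturality

variable {F G : AbSheaf Y} {F' G' : AbSheaf X} {k : F ⟶ (push g).obj F'}
  {l : G ⟶ (push g).obj G'} {φ : F ⟶ G} {φ' : F' ⟶ G'}

lemma discComap_naturality (h : φ ≫ l = k ≫ (push g).map φ') :
    (disc Y).map φ ≫ discComap g l = discComap g k ≫ (push g).map ((disc X).map φ') := by
  refine AbSheaf.hom_ext fun U s => funext fun x => ?_
  change stalkComap g l x (stalkMap (g x) φ (s ⟨g x, x.2⟩)) =
    stalkMap (x : X) φ' (stalkComap g k x (s ⟨g x, x.2⟩))
  obtain ⟨V, hV, t, ht⟩ := TopCat.Presheaf.exists_germ_eq _ (s ⟨g x, x.2⟩)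
  rw [← ht, stalkMap_germ, stalkComap_germ, stalkComap_germ]
  refine Eq.trans ?_ (stalkMap_germ (x : X) φ' ((Opens.map g).obj V) hV _).symm
  refine congrArg (G'.presheaf.germ ((Opens.map g).obj V) (x : X) hV) ?_
  exact DFunLike.congr_fun (congrArg (fun m => (m.hom.app (op V)).hom) h) t

lemma quotComap_naturality (h : φ ≫ l = k ≫ (push g).map φ') :
    (discQuot Y).map φ ≫ quotComap g l = quotComap g k ≫ (push g).map ((discQuot X).map φ') := by
  have : Epi ((discProj Y).app F) := inferInstanceAs (Epi (cokernel.π _))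
  rw [← cancel_epi ((discProj Y).app F), ← Category.assoc, ← (discProj Y).naturality,
    Category.assoc, discProj_quotComap, ← Category.assoc, discComap_naturality g h,
    Category.assoc, ← Functor.map_comp, (discProj X).naturality, Functor.map_comp,
    ← Category.assoc, ← discProj_quotComap, Category.assoc]

lemma canBComap_naturality (h : φ ≫ l = k ≫ (push g).map φ') (p : ℕ) :
    (canB Y p).map φ ≫ canBComap g l p = canBComap g k p ≫ (push g).map ((canB X p).map φ') := by
  induction p with
  | zero => exact h
  | succ p ih => exact quotComap_naturality g ih

lemma canResComap_naturality (h : φ ≫ l = k ≫ (push g).map φ') :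
    (canRes Y).map φ ≫ canResComap g l =
      canResComap g k ≫ ((push g).mapHomologicalComplex _).map ((canRes X).map φ') := by
  ext p : 1
  exact discComap_naturality g (canBComap_naturality g h p)

end Naturality

end Comap

noncomputable section Restriction

variable {X M N : TopCat.{u}}

/-- The inclusion of an open subspace. -/
abbrev incl (U : Opens X) : TopCat.of U ⟶ X := U.inclusion'

/-- The restriction `F ↦ F|_U` of abelian sheaves to an open subspace. -/
def restr (U : Opens X) : AbSheaf X ⥤ AbSheaf (TopCat.of U) := U.sheafRestrict

instance (U : Opens X) : (restr U).Additive where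
  map_add := rfl

instance (U : Opens X) : (restr U).IsRightAdjoint :=
  inferInstanceAs (U.sheafRestrict (C := AddCommGrpCat.{u})).IsRightAdjoint

instance (U : Opens X) : (restr U).IsLeftAdjoint :=
  ((TopCat.Sheaf.pullbackPushforwardAdjunction AddCommGrpCat.{u} (incl U)).ofNatIsoLeft
    (U.isOpenEmbedding.sheafPullbackIso AddCommGrpCat.{u})).isLeftAdjoint

instance (U : Opens X) : (restr U).PreservesHomology := inferInstance

/-- The restriction of sections `F(W) → F(W ∩ U)` as a morphism `F ⟶ j_* (F|_U)`, where `j` is the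
inclusion of `U`. -/
def toPushRestr (U : Opens X) : 𝟭 (AbSheaf X) ⟶ restr U ⋙ push (incl U) where
  app F := ⟨{
    app := fun W => F.presheaf.map
      (homOfLE (by rintro _ ⟨x, hx, rfl⟩; exact hx) :
        U.isOpenEmbedding.isOpenMap.functor.obj ((Opens.map (incl U)).obj W.unop) ⟶ W.unop).op
    naturality := fun W W' i => by
      refine (F.presheaf.map_comp _ _).symm.trans (Eq.trans ?_ (F.presheaf.map_comp _ _))
      rfl }⟩
  naturality F G φ := Sheaf.hom_ext (by
    ext W : 2
    exact (φ.hom.naturality _).symm)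

/-- The natural restriction homomorphism `Hᵖ(X, F) → Hᵖ(U, F|_U)`, induced by the restriction of
sections `Γ(X, 𝒜^*(F)) → Γ(U, 𝒜^*(F|_U))`. -/
def resH (U : Opens X) (p : ℕ) : cohomology X p ⟶ restr U ⋙ cohomology (TopCat.of U) p where
  app F := HomologicalComplex.homologyMap
    (((sections X).mapHomologicalComplex _).map
      (canResComap (incl U) ((toPushRestr U).app F))) p
  naturality F G φ := by
    have h := congrArg ((sections X).mapHomologicalComplex (.up ℕ) ⋙
      HomologicalComplex.homologyFunctor _ _ p).map
        (canResComap_naturality (incl U) ((toPushRestr U).naturality φ))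
    rw [Functor.map_comp, Functor.map_comp] at h
    exact h

/-- The canonical morphism `(j_* F)|_U ⟶ F`, where `j` is the inclusion of `U`; on sections over
`V ⊆ U` it is the restriction along `V = j⁻¹(j(V))`. -/
def fromPushRestr (U : Opens X) : push (incl U) ⋙ restr U ⟶ 𝟭 (AbSheaf (TopCat.of U)) where
  app F := ⟨{
    app := fun W => F.presheaf.map
      (homOfLE (fun x hx => ⟨x, hx, rfl⟩) : W.unop ⟶ (Opens.map (incl U)).obj
        (U.isOpenEmbedding.isOpenMap.functor.obj W.unop)).op
    naturality := fun W W' i => by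
      refine (F.presheaf.map_comp _ _).symm.trans (Eq.trans ?_ (F.presheaf.map_comp _ _))
      rfl }⟩
  naturality F G φ := Sheaf.hom_ext (by
    ext W : 2
    exact (φ.hom.naturality _).symm)

/-- The map `f' : f⁻¹(N') → N'` obtained by restricting `f : M → N`. -/
def restrMap (f : M ⟶ N) (N' : Opens N) :
    TopCat.of ((Opens.map f).obj N') ⟶ TopCat.of N' :=
  TopCat.ofHom (f.hom.restrictPreimage N')

/-- The morphism of complexes `(f_* 𝒜^*(S))|_{N'} ⟶ f'_* 𝒜^*(S|_{M'})`, where `M' = f⁻¹(N')`. -/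
def directImageRestr (f : M ⟶ N) (N' : Opens N) :
    directImageComplex f ⋙ (restr N').mapHomologicalComplex (.up ℕ) ⟶
      restr ((Opens.map f).obj N') ⋙ directImageComplex (restrMap f N') where
  app S :=
    ((restr N').mapHomologicalComplex _).map (((push f).mapHomologicalComplex _).map
      (canResComap (incl ((Opens.map f).obj N')) ((toPushRestr _).app S))) ≫
    (NatTrans.mapHomologicalComplex (fromPushRestr N') _).app
      ((directImageComplex (restrMap f N')).obj ((restr _).obj S))
  naturality S T φ := by
    have h := congrArg ((push f).mapHomologicalComplex (.up ℕ) ⋙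
      (restr N').mapHomologicalComplex (.up ℕ)).map (canResComap_naturality
        (incl ((Opens.map f).obj N')) ((toPushRestr ((Opens.map f).obj N')).naturality φ))
    have h' := (NatTrans.mapHomologicalComplex (fromPushRestr N') (.up ℕ)).naturality
      ((directImageComplex (restrMap f N')).map ((restr _).map φ))
    rw [Functor.map_comp, Functor.map_comp] at h
    refine (Category.assoc _ _ _).symm.trans ?_
    refine (congrArg (· ≫ _) h).trans ?_
    refine (Category.assoc _ _ _).trans ?_
    refine (congrArg (_ ≫ ·) h').trans ?_
    exact (Category.assoc _ _ _).symm

/-- Restriction to an open subspace is exact, hence commutes with cohomology sheaves: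
`H^q(K)|_U ≅ H^q(K|_U)`. -/
def homologyRestrIso (U : Opens X) (q : ℕ) :
    HomologicalComplex.homologyFunctor (AbSheaf X) (.up ℕ) q ⋙ restr U ≅
      (restr U).mapHomologicalComplex (.up ℕ) ⋙ HomologicalComplex.homologyFunctor _ _ q :=
  NatIso.ofComponents (fun K => ((K.sc q).mapHomologyIso (restr U)).symm) fun φ =>
    ShortComplex.mapHomologyIso_inv_naturality
      ((HomologicalComplex.shortComplexFunctor _ _ q).map φ) (restr U)

/-- The canonical natural transformation `(R^q f_* S)|_{N'} ⟶ R^q f'_* (S|_{M'})`, where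
`M' = f⁻¹(N')` and `f' : M' → N'` is the restriction of `f`. -/
def higherDirectImageRestr (f : M ⟶ N) (N' : Opens N) (q : ℕ) :
    higherDirectImage f q ⋙ restr N' ⟶
      restr ((Opens.map f).obj N') ⋙ higherDirectImage (restrMap f N') q :=
  Functor.whiskerLeft (directImageComplex f) (homologyRestrIso N' q).hom ≫
    Functor.whiskerRight (directImageRestr f N') (HomologicalComplex.homologyFunctor _ _ q)

/-- The restriction `Hᵖ(N, R^q f_* S) → Hᵖ(N', (R^q f_* S)|_{N'})` composed with the map induced by
`(R^q f_* S)|_{N'} ⟶ R^q f'_* (S|_{M'})`. -/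
def lerayRes (f : M ⟶ N) (S : AbSheaf M) (N' : Opens N) (p q : ℕ) :
    (cohomology N p).obj ((higherDirectImage f q).obj S) ⟶
      (cohomology (TopCat.of N') p).obj ((higherDirectImage (restrMap f N') q).obj
        ((restr ((Opens.map f).obj N')).obj S)) :=
  (resH N' p).app ((higherDirectImage f q).obj S) ≫
    (cohomology (TopCat.of N') p).map ((higherDirectImageRestr f N' q).app S)

end Restriction

end Leray

/-!
Restricting to an open subset does not change stalks. Along an open embedding `g : X → Y`, a
morphism `k : F ⟶ g_* F'` that is bijective on the stalks at points of `X` therefore induces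
bijections on the stalks of `𝒜⁰` and of the quotients `ℬᵖ` (`canBComap_stalk_bijective`). Applied to
the inclusion of `M' = f⁻¹(N')`, this makes the comparison `(f_* 𝒜^*(S))|_{N'} ⟶ f'_* 𝒜^*(S|_{M'})`
an isomorphism of complexes, and hence an isomorphism on cohomology sheaves
(`isIso_higherDirectImageRestr`).

For the square, the comparison gives a morphism of complexes `f_* 𝒜^*(S) ⟶ j_* f'_* 𝒜^*(S|_{M'})`,
where `j : N' → N` is the inclusion, and so a morphism of double complexes `lerayDoubleRestr`. It
commutes with the total differentials and preserves the filtrations and the groups `Z_2`, on which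
`d_2` is given by the total differential (`lerayD₂_lerayClass`). It remains to see that on
`E_2^{p,q} = Hᵖ(N, R^q f_* S)` it is the vertical map of the square (`lerayRes_lerayClass`): the class
of an element of `Z_2` depends only on its leading component, a `∂̄`-cocycle, that is, a section of
`𝒜ᵖ` of the sheaf of `q`-cocycles, and there the claim is naturality of `𝒜ᵖ` with respect to the
inclusion of cocycles and the projection to cohomology (`fromZ_mapZ_canDoubleHom`).
-/

namespace Leray

/-! ### Morphisms of double complexes and the second term -/

noncomputable section SecondTermMap

/-- The class of a cocycle is natural with respect to morphisms of complexes. -/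
lemma homologyMap_cls {C D : CochainComplex AddCommGrpCat.{u} ℕ} (η : C ⟶ D) (p : ℕ)
    (x : (C.d p (p + 1)).hom.ker) (y : (D.d p (p + 1)).hom.ker) (h : η.f p x.1 = y.1) :
    HomologicalComplex.homologyMap η p (cls C p x) = cls D p y := by
  have hinj := (AddCommGrpCat.mono_iff_injective (D.iCycles p)).1 inferInstance
  have hc : HomologicalComplex.cyclesMap η p (kerToCycles C p x) = kerToCycles D p y := by
    apply hinj
    rw [iCycles_kerToCycles, ← h, ← iCycles_kerToCycles C p x]
    exact ConcreteCategory.congr_hom (HomologicalComplex.cyclesMap_i η p) _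
  have h1 := ConcreteCategory.congr_hom (HomologicalComplex.homologyπ_naturality η p)
    (kerToCycles C p x)
  exact h1.trans (congrArg (D.homologyπ p) hc)

namespace DoubleComplex

/-- A morphism of double complexes: homomorphisms `A^{p,q} → B^{p,q}` commuting with `∂` and
`∂̄`. -/
structure Hom (A B : DoubleComplex.{u}) where
  /-- the component in bidegree `(p, q)` -/
  app : ∀ p q, A.A p q →+ B.A p q
  comm_dh : ∀ p q x, app (p + 1) q (A.dh p q x) = B.dh p q (app p q x)
  comm_dv : ∀ p q x, app p (q + 1) (A.dv p q x) = B.dv p q (app p q x)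

namespace Hom

variable {A B : DoubleComplex.{u}} (φ : A.Hom B)

/-- The map of total complexes in degree `n`. -/
def totMap {n : ℕ} (x : A.TotX n) : B.TotX n := fun i => φ.app i.1.1 i.1.2 (x i)

lemma totD_totMap {n : ℕ} (x : A.TotX n) : B.totD n (φ.totMap x) = φ.totMap (A.totD n x) := by
  funext ⟨⟨a, b⟩, h⟩
  change B.totH (φ.totMap x) a b h + B.totV (φ.totMap x) a b h =
    φ.app a b (A.totH x a b h + A.totV x a b h)
  rw [map_add]
  congr 1
  · rcases a with _ | a
    · exact (map_zero _).symm
    · change (-1 : ℤ) ^ n • B.dh a b (φ.app a b _) = φ.app (a + 1) b ((-1 : ℤ) ^ n • A.dh a b _)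
      rw [map_zsmul, φ.comm_dh]
  · rcases b with _ | b
    · exact (map_zero _).symm
    · exact (φ.comm_dv a b _).symm

lemma totMap_mem_filtSub {i n : ℕ} {x : A.TotX n} (hx : x ∈ A.filtSub i n) :
    φ.totMap x ∈ B.filtSub i n := by
  intro j hj
  change φ.app _ _ (x j) = 0
  rw [hx j hj, map_zero]

/-- The map `Z_2(A) → Z_2(B)` induced by a morphism of double complexes. -/
def mapZ {p n : ℕ} (x : A.filt.Z 2 p n) : B.filt.Z 2 p n :=
  ⟨φ.totMap (x.1 : A.TotX n), mem_Z_of (φ.totMap_mem_filtSub x.2.1) (Set.mem_of_eq_of_mem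
    (φ.totD_totMap (x.1 : A.TotX n))
    (φ.totMap_mem_filtSub (Set.mem_of_eq_of_mem (A.tot_d n x.1).symm x.2.2)))⟩

lemma mapZ_dZ {p n : ℕ} (x : A.filt.Z 2 p n) :
    φ.mapZ (A.filt.dZ 2 p n x) = B.filt.dZ 2 p n (φ.mapZ x) := by
  apply Subtype.ext
  change φ.totMap (A.tot.d n (n + 1) x.1) = B.tot.d n (n + 1) (φ.totMap (x.1 : A.TotX n))
  have h1 : A.tot.d n (n + 1) x.1 = A.totD n x.1 := A.tot_d n x.1
  have h2 := B.tot_d n (φ.totMap (x.1 : A.TotX n))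
  exact (congrArg φ.totMap h1).trans ((φ.totD_totMap _).symm.trans h2.symm)

/-- If a morphism `η` between the complexes of row cohomology maps the class of each `∂̄`-cocycle `z`
to the class of `φ z`, then the identification of the second term with the cohomology of these
complexes is compatible with `φ` and `η`. -/
lemma fromZ_mapZ {q : ℕ} (R : A.RowCohomology q) (R' : B.RowCohomology q) (η : R.H ⟶ R'.H)
    (hη : ∀ p z z', R'.ι p z' = φ.app p q (R.ι p z) → η.f p (R.π p z) = R'.π p z')
    {p n : ℕ} (hn : p + q = n) (x : A.filt.Z 2 p n) :
    R'.fromZ hn (φ.mapZ x) = HomologicalComplex.homologyMap η p (R.fromZ hn x) := by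
  refine (homologyMap_cls η p _ _ (hη p _ _ ?_)).symm
  rw [R.ι_lead, R'.ι_lead]
  rfl

end Hom
end DoubleComplex
end SecondTermMap

/-! ### The differential `d_2` on representatives -/

section LerayD₂

variable {M N : TopCat.{u}}

/-- The class in `Hᵖ(N, R^q f_* S)` of the leading component of an element of `Z_2^{p,q}`. -/
noncomputable def lerayClass (f : M ⟶ N) (S : AbSheaf M) {p q n : ℕ} (hn : p + q = n) :
    (lerayDouble f S).filt.Z 2 p n →+ (cohomology N p).obj ((higherDirectImage f q).obj S) :=
  (canRow ((directImageComplex f).obj S) q).fromZ hn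

lemma lerayClass_surjective (f : M ⟶ N) (S : AbSheaf M) {p q n : ℕ} (hn : p + q = n) :
    Function.Surjective (lerayClass f S hn) :=
  (canRow ((directImageComplex f).obj S) q).fromZ_surjective hn

/-- On classes of elements of `Z_2`, the differential `d_2` is the total differential. -/
lemma lerayD₂_lerayClass (f : M ⟶ N) (S : AbSheaf M) (p q : ℕ)
    (x : (lerayDouble f S).filt.Z 2 p (p + (q + 1))) :
    lerayD₂ f S p q (lerayClass f S rfl x) =
      lerayClass f S (by lia) ((lerayDouble f S).filt.dZ 2 p (p + (q + 1)) x) := by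
  have h : (lerayEquiv f S (p := p) (q := q + 1) rfl).symm (lerayClass f S rfl x) =
      QuotientAddGroup.mk x := by
    rw [AddEquiv.symm_apply_eq]
    rfl
  change lerayEquiv f S _ ((lerayDouble f S).filt.d 2 p (p + (q + 1))
    ((lerayEquiv f S (p := p) (q := q + 1) rfl).symm (lerayClass f S rfl x))) = _
  rw [h]
  rfl

end LerayD₂

/-! ### The canonical resolution along an open embedding -/

section StalkComap

variable {X Y : TopCat.{u}} {g : X ⟶ Y}

lemma stalkMap_stalkComap {F G : AbSheaf Y} {F' G' : AbSheaf X} {k : F ⟶ (push g).obj F'}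
    {l : G ⟶ (push g).obj G'} {φ : F ⟶ G} {φ' : F' ⟶ G'} (h : φ ≫ l = k ≫ (push g).map φ')
    (x : X) (t : F.presheaf.stalk (g x)) :
    stalkMap x φ' (stalkComap g k x t) = stalkComap g l x (stalkMap (g x) φ t) := by
  obtain ⟨V, hV, t, rfl⟩ := TopCat.Presheaf.exists_germ_eq _ t
  rw [stalkMap_germ, stalkComap_germ, stalkComap_germ]
  refine (stalkMap_germ x φ' ((Opens.map g).obj V) hV _).trans ?_
  refine congrArg (G'.presheaf.germ ((Opens.map g).obj V) x hV) ?_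
  exact (DFunLike.congr_fun (congrArg (fun m => (m.hom.app (op V)).hom) h) t).symm

/-- If `k : F ⟶ g_* F'` is an isomorphism on stalks, then `𝒜⁰(F)(U) → 𝒜⁰(F')(g⁻¹(U))` is bijective
for `U` contained in the image of the injective map `g`. -/
lemma discComap_app_bijective (hg : Function.Injective g) {F : AbSheaf Y} {F' : AbSheaf X}
    (k : F ⟶ (push g).obj F') (hk : ∀ x, Function.Bijective (stalkComap g k x)) (U : Opens Y)
    (hU : ∀ y ∈ U, ∃ x, g x = y) :
    Function.Bijective ((discComap g k).hom.app (op U)) := by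
  constructor
  · intro s t h
    funext ⟨y, hy⟩
    obtain ⟨x, rfl⟩ := hU y hy
    exact (hk x).1 (congrFun h (⟨x, hy⟩ : (Opens.map g).obj U))
  · intro s
    -- The equality `e` transports values between the stalks at propositionally equal points.
    have key : ∀ y : U, ∃ t : F.presheaf.stalk (y : Y), ∀ x (hx : g x ∈ U) (e : y = ⟨g x, hx⟩),
        stalkComap g k x (cast (congrArg (fun y : U => (F.presheaf.stalk (y : Y) : Type u)) e) t) =
          (s : ∀ x : (Opens.map g).obj U, F'.presheaf.stalk (x : X)) ⟨x, hx⟩ := by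
      rintro ⟨y, hy⟩
      obtain ⟨x, rfl⟩ := hU y hy
      obtain ⟨t, ht⟩ := (hk x).2
        ((s : ∀ x : (Opens.map g).obj U, F'.presheaf.stalk (x : X)) ⟨x, hy⟩)
      refine ⟨t, fun x' hx' e => ?_⟩
      obtain rfl : x = x' := hg (congrArg Subtype.val e)
      exact ht
    choose t ht using key
    exact ⟨t, funext fun x => ht ⟨g x, x.2⟩ x.1 x.2 rfl⟩

/-- Along an open embedding `g`, a morphism `k : F ⟶ g_* F'` that is bijective on sections over all
open subsets of the image of `g` is bijective on stalks at the points of `X`: such open sets are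
cofinal among the neighbourhoods of `g x`. -/
lemma stalkComap_bijective (hg : Topology.IsOpenEmbedding g) {F : AbSheaf Y} {F' : AbSheaf X}
    (k : F ⟶ (push g).obj F')
    (hk : ∀ U : Opens Y, (∀ y ∈ U, ∃ x, g x = y) → Function.Bijective (k.hom.app (op U)))
    (x : X) : Function.Bijective (stalkComap g k x) := by
  let W : Opens Y := ⟨Set.range g, hg.isOpen_range⟩
  have hW (V : Opens Y) : ∀ y ∈ V ⊓ W, ∃ x, g x = y := fun y hy => hy.2
  have hpush := TopCat.Presheaf.stalkPushforward.stalkPushforward_iso_of_isInducing AddCommGrpCat.{u}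
    (f := g) hg.isInducing F'.presheaf x
  have hb : Function.Bijective (F'.presheaf.stalkPushforward AddCommGrpCat.{u} g x) :=
    (ConcreteCategory.isIso_iff_bijective _).1 hpush
  have hmem (V : Opens Y) (hV : g x ∈ V) : g x ∈ V ⊓ W := ⟨hV, Set.mem_range_self x⟩
  suffices h : Function.Bijective (stalkMap (g x) k) from hb.comp h
  constructor
  · rw [injective_iff_map_eq_zero]
    intro t ht
    obtain ⟨V, hV, s, rfl⟩ := TopCat.Presheaf.exists_germ_eq _ t
    rw [stalkMap_germ] at ht
    obtain ⟨V', hV', i₁, i₂, h⟩ := TopCat.Presheaf.germ_eq _ (g x) hV hV _ _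
      (ht.trans (map_zero (((push g).obj F').presheaf.germ V (g x) hV).hom).symm)
    let i : V' ⊓ W ⟶ V := homOfLE (inf_le_left.trans i₁.le)
    have h0 : F.presheaf.map i.op s = 0 := by
      apply (hk _ (hW V')).1
      refine (ConcreteCategory.congr_hom (k.hom.naturality i.op) s).trans ?_
      have e := congrArg (((push g).obj F').presheaf.map (homOfLE inf_le_left : V' ⊓ W ⟶ V').op)
        (h.trans (map_zero _))
      refine Eq.trans ?_ (e.trans ((map_zero _).trans (map_zero _).symm))
      exact ConcreteCategory.congr_hom
        (((push g).obj F').presheaf.map_comp i₁.op (homOfLE inf_le_left : V' ⊓ W ⟶ V').op) _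
    rw [← TopCat.Presheaf.germ_res_apply F.presheaf i (g x) (hmem V' hV') s, h0, map_zero]
  · intro t
    obtain ⟨V, hV, s, rfl⟩ := TopCat.Presheaf.exists_germ_eq _ t
    let i : V ⊓ W ⟶ V := homOfLE inf_le_left
    obtain ⟨s', hs'⟩ := (hk _ (hW V)).2 (((push g).obj F').presheaf.map i.op s)
    refine ⟨F.presheaf.germ (V ⊓ W) (g x) (hmem V hV) s', ?_⟩
    rw [stalkMap_germ, hs']
    exact TopCat.Presheaf.germ_res_apply _ i _ _ _

lemma discComap_stalk_bijective (hg : Topology.IsOpenEmbedding g) {F : AbSheaf Y} {F' : AbSheaf X}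
    (k : F ⟶ (push g).obj F')
    (hk : ∀ x, Function.Bijective (stalkComap g k x)) (x : X) :
    Function.Bijective (stalkComap g (discComap g k) x) :=
  stalkComap_bijective hg _ (discComap_app_bijective hg.injective k hk) x

/-- The five lemma on stalks for the sequences `F → 𝒜⁰(F) → ℬ¹(F) → 0`. -/
lemma quotComap_stalk_bijective (hg : Topology.IsOpenEmbedding g) {F : AbSheaf Y} {F' : AbSheaf X}
    (k : F ⟶ (push g).obj F')
    (hk : ∀ x, Function.Bijective (stalkComap g k x)) (x : X) :
    Function.Bijective (stalkComap g (quotComap g k) x) := by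
  have hd := discComap_stalk_bijective hg k hk x
  have hsurj {Z : TopCat.{u}} (G : AbSheaf Z) (z : Z) :
      Function.Surjective (stalkMap z ((discProj Z).app G)) := by
    have : Epi ((discProj Z).app G) := inferInstanceAs (Epi (cokernel.π _))
    exact fun b => stalkMap_exact ((ShortComplex.exact_iff_epi
      (ShortComplex.mk ((discProj Z).app G) (0 : (discQuot Z).obj G ⟶ (discQuot Z).obj G)
        comp_zero) rfl).2 this) z b (by rw [stalkMap_zero]; rfl)
  have hw {Z : TopCat.{u}} (G : AbSheaf Z) : (toDisc Z).app G ≫ (discProj Z).app G = 0 :=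
    cokernel.condition _
  have hex {Z : TopCat.{u}} (G : AbSheaf Z) : (ShortComplex.mk _ _ (hw G)).Exact :=
    ShortComplex.exact_cokernel ((toDisc Z).app G)
  have hc (t) := stalkMap_stalkComap (discProj_quotComap g k) x t
  have hc' (t) := stalkMap_stalkComap (toDisc_discComap g k) x t
  constructor
  · rw [injective_iff_map_eq_zero]
    intro b hb
    obtain ⟨t, rfl⟩ := hsurj F (g x) b
    obtain ⟨u', hu'⟩ := stalkMap_exact (hex F') x (stalkComap g (discComap g k) x t)
      ((hc t).trans hb)
    obtain ⟨u, rfl⟩ := (hk x).2 u'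
    have : stalkMap (g x) ((toDisc Y).app F) u = t := hd.1 ((hc' u).symm.trans hu')
    rw [← this]
    have h0 := DFunLike.congr_fun (congrArg (stalkMap (g x)) (hw F)) u
    rwa [stalkMap_comp, stalkMap_zero] at h0
  · intro b
    obtain ⟨t', rfl⟩ := hsurj F' x b
    obtain ⟨t, rfl⟩ := hd.2 t'
    exact ⟨_, (hc t).symm⟩

lemma canBComap_stalk_bijective (hg : Topology.IsOpenEmbedding g) {F : AbSheaf Y} {F' : AbSheaf X}
    (k : F ⟶ (push g).obj F')
    (hk : ∀ x, Function.Bijective (stalkComap g k x)) (p : ℕ) (x : X) :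
    Function.Bijective (stalkComap g (canBComap g k p) x) := by
  induction p generalizing x with
  | zero => exact hk x
  | succ p ih => exact quotComap_stalk_bijective hg _ ih x

end StalkComap

/-! ### Restriction of higher direct images is an isomorphism -/

section RestrictionIso

variable {X M N : TopCat.{u}}

lemma toPushRestr_stalk_bijective (U : Opens X) (F : AbSheaf X) (x : TopCat.of U) :
    Function.Bijective (stalkComap (incl U) ((toPushRestr U).app F) x) := by
  refine stalkComap_bijective (g := incl U) U.isOpenEmbedding _ (fun V hV => ?_) x
  rw [← ConcreteCategory.isIso_iff_bijective]
  have e : V = U.isOpenEmbedding.isOpenMap.functor.obj ((Opens.map (incl U)).obj V) := by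
    ext y
    constructor
    · intro hy
      obtain ⟨x, rfl⟩ := hV y hy
      exact ⟨x, hy, rfl⟩
    · rintro ⟨x, hx, rfl⟩
      exact hx
  have hi : IsIso (homOfLE e.ge) := ⟨homOfLE e.le, rfl, rfl⟩
  exact F.presheaf.map_isIso (homOfLE e.ge).op

lemma isIso_of_app_bijective {F G : AbSheaf X} (φ : F ⟶ G)
    (h : ∀ U : Opens X, Function.Bijective (φ.hom.app (op U))) : IsIso φ := by
  have h1 (U : (Opens X)ᵒᵖ) : IsIso (φ.hom.app U) :=
    (ConcreteCategory.isIso_iff_bijective _).2 (h U.unop)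
  have h2 : IsIso φ.hom := NatIso.isIso_of_isIso_app φ.hom
  have : IsIso ((TopCat.Sheaf.forget AddCommGrpCat.{u} X).map φ) := h2
  exact isIso_of_reflects_iso φ (TopCat.Sheaf.forget AddCommGrpCat.{u} X)

/-- In degree `p`, over an open `W ⊆ N'`, the morphism sends a discontinuous section of `ℬᵖ(S)` over
`f⁻¹(W)` to the family of its images under the isomorphisms `ℬᵖ(S)_x ≅ ℬᵖ(S|_{M'})_x`, followed by
restriction along an equality of open sets. -/
instance isIso_directImageRestr (f : M ⟶ N) (N' : Opens N) : IsIso (directImageRestr f N') := by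
  have hb (S : AbSheaf M) (p : ℕ) : IsIso (((directImageRestr f N').app S).f p) := by
    refine isIso_of_app_bijective _ fun W => ?_
    have hk := canBComap_stalk_bijective (g := incl ((Opens.map f).obj N'))
      ((Opens.map f).obj N').isOpenEmbedding ((toPushRestr _).app S)
      (toPushRestr_stalk_bijective _ S) p
    have hd := discComap_app_bijective (g := incl ((Opens.map f).obj N'))
      Subtype.val_injective _ hk
      ((Opens.map f).obj (N'.isOpenEmbedding.isOpenMap.functor.obj W)) (by
        rintro y ⟨z, hz, e⟩
        exact ⟨⟨y, show f y ∈ N' from e ▸ z.2⟩, rfl⟩)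
    -- `W = j⁻¹(j(W))`, so that the second factor restricts along an equality of open sets.
    have e : W = (Opens.map (incl N')).obj (N'.isOpenEmbedding.isOpenMap.functor.obj W) := by
      ext y
      constructor
      · intro hy
        exact ⟨y, hy, rfl⟩
      · rintro ⟨x, hx, hxy⟩
        obtain rfl : x = y := Subtype.ext hxy
        exact hx
    let G := (push (restrMap f N')).obj
      ((canA _ p).obj ((restr ((Opens.map f).obj N')).obj S))
    have hi : IsIso (homOfLE e.le) := ⟨homOfLE e.ge, rfl, rfl⟩
    have hG : Function.Bijective (G.presheaf.map (homOfLE e.le).op) :=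
      (ConcreteCategory.isIso_iff_bijective _).1 (G.presheaf.map_isIso (homOfLE e.le).op)
    exact hG.comp hd
  have hS (S : AbSheaf M) : IsIso ((directImageRestr f N').app S) :=
    HomologicalComplex.Hom.isIso_of_components _
  exact NatIso.isIso_of_isIso_app _

instance isIso_higherDirectImageRestr (f : M ⟶ N) (N' : Opens N) (q : ℕ) :
    IsIso (higherDirectImageRestr f N' q) := by
  have h1 : IsIso (Functor.whiskerLeft (directImageComplex f) (homologyRestrIso N' q).hom) :=
    inferInstance
  have h2 : IsIso (Functor.whiskerRight (directImageRestr f N')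
      (HomologicalComplex.homologyFunctor (AbSheaf (TopCat.of N')) (.up ℕ) q)) := inferInstance
  exact IsIso.comp_isIso' h1 h2

end RestrictionIso

/-! ### Restriction of double complexes and its effect on the second term -/

section CanDoubleMap

variable {X Y : TopCat.{u}} (g : X ⟶ Y)

/-- A morphism of complexes `κ : K ⟶ g_* K'` induces homomorphisms
`Γ(Y, 𝒜ᵖ(K^q)) → Γ(X, 𝒜ᵖ(K'^q))`. -/
noncomputable def canDoubleHom {K : CochainComplex (AbSheaf Y) ℕ}
    {K' : CochainComplex (AbSheaf X) ℕ}
    (κ : K ⟶ ((push g).mapHomologicalComplex _).obj K') :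
    (canDouble K).Hom (canDouble K') where
  app p q := ((sections Y).map (canAComap g (κ.f q) p)).hom
  comm_dh p q x := by
    have h := congrArg (sections Y).map (canAComap_comm g (κ.f q) p)
    rw [Functor.map_comp, Functor.map_comp] at h
    exact (ConcreteCategory.congr_hom h x).symm
  comm_dv p q x := by
    have hκ : K.d q (q + 1) ≫ κ.f (q + 1) = κ.f q ≫ (push g).map (K'.d q (q + 1)) :=
      (κ.comm q (q + 1)).symm
    have h := congrArg (sections Y).map
      (discComap_naturality g (canBComap_naturality g hκ p))
    rw [Functor.map_comp, Functor.map_comp] at h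
    exact ConcreteCategory.congr_hom h x

/-- The identification of the second term with `Hᵖ(H^q(K))` is natural: if `θ` is induced by `κ` on
cohomology sheaves, through a morphism `ζ` on sheaves of cocycles, then `κ` induces on the second
terms the map induced by `θ`. -/
lemma fromZ_mapZ_canDoubleHom {K : CochainComplex (AbSheaf Y) ℕ}
    {K' : CochainComplex (AbSheaf X) ℕ}
    (κ : K ⟶ ((push g).mapHomologicalComplex _).obj K') {q : ℕ}
    (ζ : K.cycles q ⟶ (push g).obj (K'.cycles q))
    (θ : K.homology q ⟶ (push g).obj (K'.homology q))
    (hζ : K.iCycles q ≫ κ.f q = ζ ≫ (push g).map (K'.iCycles q))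
    (hθ : K.homologyπ q ≫ θ = ζ ≫ (push g).map (K'.homologyπ q))
    {p n : ℕ} (hn : p + q = n) (x : (canDouble K).filt.Z 2 p n) :
    (canRow K' q).fromZ hn ((canDoubleHom g κ).mapZ x) =
      HomologicalComplex.homologyMap
        (((sections Y).mapHomologicalComplex _).map (canResComap g θ)) p
        ((canRow K q).fromZ hn x) := by
  refine (canDoubleHom g κ).fromZ_mapZ (canRow K q) (canRow K' q)
    (((sections Y).mapHomologicalComplex _).map (canResComap g θ)) (fun p z z' hz => ?_) hn x
  have h1 := congrArg (sections Y).map (discComap_naturality g (canBComap_naturality g hζ p))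
  have h2 := congrArg (sections Y).map (discComap_naturality g (canBComap_naturality g hθ p))
  rw [Functor.map_comp, Functor.map_comp] at h1 h2
  have hz' : z' = (sections Y).map (canAComap g ζ p) z :=
    (canRow K' q).ι_injective p (hz.trans (ConcreteCategory.congr_hom h1 z))
  rw [hz']
  exact ConcreteCategory.congr_hom h2 z

end CanDoubleMap

/-! ### Restriction of the Leray spectral sequence -/

section LerayMap

variable {X M N : TopCat.{u}}

/-- The identification `Z^q(K)|_U ≅ Z^q(K|_U)` of sheaves of cocycles. -/
noncomputable def cyclesRestr (U : Opens X) (K : CochainComplex (AbSheaf X) ℕ) (q : ℕ) :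
    (restr U).obj (K.cycles q) ⟶ (((restr U).mapHomologicalComplex (.up ℕ)).obj K).cycles q :=
  ((K.sc q).mapCyclesIso (restr U)).inv

lemma cyclesRestr_iCycles (U : Opens X) (K : CochainComplex (AbSheaf X) ℕ) (q : ℕ) :
    cyclesRestr U K q ≫ (((restr U).mapHomologicalComplex (.up ℕ)).obj K).iCycles q =
      (restr U).map (K.iCycles q) :=
  (Iso.inv_comp_eq _).2 ((K.sc q).mapCyclesIso_hom_iCycles (restr U)).symm

/-- The isomorphism `H^q(K)|_U ≅ H^q(K|_U)` is compatible with the projections from the sheaves of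
cocycles. -/
lemma map_homologyπ_homologyRestrIso (U : Opens X) (K : CochainComplex (AbSheaf X) ℕ) (q : ℕ) :
    (restr U).map (K.homologyπ q) ≫ (homologyRestrIso U q).hom.app K =
      cyclesRestr U K q ≫ (((restr U).mapHomologicalComplex (.up ℕ)).obj K).homologyπ q := by
  have h : ((K.sc q).map (restr U)).homologyπ ≫ ((K.sc q).mapHomologyIso (restr U)).hom =
      ((K.sc q).mapCyclesIso (restr U)).hom ≫ (restr U).map (K.sc q).homologyπ := by
    have h1 := (K.sc q).homologyData.left.homologyπ_comp_homologyIso_hom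
    have h2 := ((K.sc q).homologyData.left.map (restr U)).homologyπ_comp_homologyIso_hom
    rw [(K.sc q).homologyData.left.mapHomologyIso_eq, (K.sc q).homologyData.left.mapCyclesIso_eq]
    have h3 : (K.sc q).homologyData.left.π ≫ (K.sc q).homologyData.left.homologyIso.inv =
        (K.sc q).homologyData.left.cyclesIso.inv ≫ (K.sc q).homologyπ := by
      rw [Iso.comp_inv_eq, Category.assoc, h1, Iso.inv_hom_id_assoc]
    have h4 := congrArg (restr U).map h3
    rw [Functor.map_comp, Functor.map_comp] at h4
    refine (Category.assoc _ _ _).symm.trans ((congrArg (· ≫ _) h2).trans ?_)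
    refine (Category.assoc _ _ _).trans ((congrArg (_ ≫ ·) h4).trans ?_)
    exact (Category.assoc _ _ _).symm
  exact (Iso.comp_inv_eq _).2 (((Iso.eq_inv_comp _).2 h.symm).trans (Category.assoc _ _ _).symm)

/-- The morphism of complexes `f_* 𝒜^*(S) ⟶ j_* f'_* 𝒜^*(S|_{M'})`, where `j` is the inclusion of
`N'` in `N`. -/
noncomputable def directImageComap (f : M ⟶ N) (N' : Opens N) (S : AbSheaf M) :
    (directImageComplex f).obj S ⟶ ((push (incl N')).mapHomologicalComplex _).obj
      ((directImageComplex (restrMap f N')).obj ((restr ((Opens.map f).obj N')).obj S)) :=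
  (NatTrans.mapHomologicalComplex (toPushRestr N') _).app ((directImageComplex f).obj S) ≫
    ((push (incl N')).mapHomologicalComplex _).map ((directImageRestr f N').app S)

/-- The morphism from the double complex of `(S, f)` to that of `(S|_{M'}, f')` given by restriction
of sections. -/
noncomputable def lerayDoubleRestr (f : M ⟶ N) (S : AbSheaf M) (N' : Opens N) :
    (lerayDouble f S).Hom
      (lerayDouble (restrMap f N') ((restr ((Opens.map f).obj N')).obj S)) :=
  canDoubleHom (incl N') (directImageComap f N' S)

/-- The map `Hᵖ(N, R^q f_* S) → Hᵖ(N', R^q f'_* (S|_{M'}))` is induced by the morphism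
`R^q f_* S ⟶ j_* R^q f'_* (S|_{M'})` corresponding to the restriction of higher direct images. -/
lemma lerayRes_eq (f : M ⟶ N) (S : AbSheaf M) (N' : Opens N) (p q : ℕ) :
    lerayRes f S N' p q = HomologicalComplex.homologyMap
      (((sections N).mapHomologicalComplex _).map (canResComap (incl N')
        ((toPushRestr N').app ((higherDirectImage f q).obj S) ≫
          (push (incl N')).map ((higherDirectImageRestr f N' q).app S)))) p := by
  have h := canResComap_naturality (incl N') (φ := 𝟙 _)
    (k := (toPushRestr N').app ((higherDirectImage f q).obj S))
    (φ' := (higherDirectImageRestr f N' q).app S) (Category.id_comp _)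
  rw [(canRes N).map_id, Category.id_comp] at h
  rw [h, Functor.map_comp, HomologicalComplex.homologyMap_comp]
  rfl

/-- Restriction of the total complex to `N'` induces `lerayRes` on the second term. -/
lemma lerayRes_lerayClass (f : M ⟶ N) (S : AbSheaf M) (N' : Opens N) {p q n : ℕ}
    (hn : p + q = n) (x : (lerayDouble f S).filt.Z 2 p n) :
    lerayRes f S N' p q (lerayClass f S hn x) =
      lerayClass (restrMap f N') ((restr ((Opens.map f).obj N')).obj S) hn
        ((lerayDoubleRestr f S N').mapZ x) := by
  rw [lerayRes_eq]
  let K := (directImageComplex f).obj S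
  let K' := (directImageComplex (restrMap f N')).obj ((restr ((Opens.map f).obj N')).obj S)
  let ρ : ((restr N').mapHomologicalComplex _).obj K ⟶ K' := (directImageRestr f N').app S
  have hζ : (restr N').map (K.iCycles q) ≫ ρ.f q =
      (cyclesRestr N' K q ≫ HomologicalComplex.cyclesMap ρ q) ≫ K'.iCycles q := by
    rw [Category.assoc, HomologicalComplex.cyclesMap_i, ← Category.assoc, cyclesRestr_iCycles]
    rfl
  have hθ : (restr N').map (K.homologyπ q) ≫ (higherDirectImageRestr f N' q).app S =
      (cyclesRestr N' K q ≫ HomologicalComplex.cyclesMap ρ q) ≫ K'.homologyπ q := by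
    refine (Category.assoc _ _ _).symm.trans
      ((congrArg (· ≫ _) (map_homologyπ_homologyRestrIso N' K q)).trans ?_)
    refine (Category.assoc _ _ _).trans (Eq.trans ?_ (Category.assoc _ _ _).symm)
    exact congrArg (_ ≫ ·) (HomologicalComplex.homologyπ_naturality ρ q)
  -- A commutative square of sheaves on `N'` gives one on `N` by applying `j_*` and composing with
  -- the natural restriction `F ⟶ j_* (F|_{N'})`.
  have key {F G : AbSheaf N} {F' G' : AbSheaf (TopCat.of N')} (a : F ⟶ G)
      (b : (restr N').obj G ⟶ G') (c : (restr N').obj F ⟶ F') (d : F' ⟶ G')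
      (h : (restr N').map a ≫ b = c ≫ d) :
      a ≫ (toPushRestr N').app G ≫ (push (incl N')).map b =
        ((toPushRestr N').app F ≫ (push (incl N')).map c) ≫ (push (incl N')).map d := by
    have h' := congrArg (push (incl N')).map h
    rw [Functor.map_comp, Functor.map_comp] at h'
    rw [Category.assoc, ← h']
    exact (Category.assoc _ _ _).symm.trans ((congrArg (· ≫ _)
      ((toPushRestr N').naturality a)).trans (Category.assoc _ _ _))
  exact (fromZ_mapZ_canDoubleHom (incl N') (directImageComap f N' S) _ _
    (key _ _ _ _ hζ) (key _ _ _ _ hθ) hn x).symm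

end LerayMap

end Leray

theorem theoremt {M N : TopCat.{u}} (f : M ⟶ N) (S : TopCat.Sheaf AddCommGrpCat.{u} M)
    (N' : Opens N) :
    (∀ i : ℕ, IsIso (Leray.higherDirectImageRestr f N' i)) ∧
    ∀ p q : ℕ,
      Leray.lerayD₂ f S p q ≫ Leray.lerayRes f S N' (p + 2) q =
        Leray.lerayRes f S N' p (q + 1) ≫
          Leray.lerayD₂ (Leray.restrMap f N')
            ((Leray.restr ((Opens.map f).obj N')).obj S) p q := by
  refine ⟨fun i => Leray.isIso_higherDirectImageRestr f N' i, fun p q => ?_⟩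
  ext e
  obtain ⟨x, rfl⟩ := Leray.lerayClass_surjective f S (q := q + 1) rfl e
  change Leray.lerayRes f S N' (p + 2) q (Leray.lerayD₂ f S p q _) =
    Leray.lerayD₂ _ _ p q (Leray.lerayRes f S N' p (q + 1) _)
  rw [Leray.lerayD₂_lerayClass, Leray.lerayRes_lerayClass, Leray.lerayRes_lerayClass,
    Leray.lerayD₂_lerayClass]
  exact congrArg _ (Leray.DoubleComplex.Hom.mapZ_dZ _ x)
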